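/- Let $M$ be a smooth manifold of dimension $p+q$ with a smooth foliation $\mathcal F$ with leaves of dimension $p$ (codimension $q$), and let $N=N(M,\mathcal F)=TM/T\mathcal F$ be its normal bundle, with projection $\pi:N\to M$. Let $(D,g)$ be a transversely Hessian structure on $(M,\mathcal F)$: $D$ is a flat torsion-free foliated connection in $N$, and $g$ is a Riemannian metric of $N$ such that in every adapted foliated affine coordinate system $(x^1,\dots,x^p,y^1,\dots,y^q)$ (an adapted chart of $\mathcal F$, so that $T\mathcal F=\ker dy$, in which the sections $\overline{\partial/\partial y^i}$ of $N$ are $D$-parallel) one has locally $g_{ij}=\partial^2 h/\partial y^i\partial y^j$ for a smooth basic function $h=h(y)$. The total space $N$ carries the foliation $\mathcal F_N$ of codimension $2q$ with transverse coordinates $(y^i,dy^i)$, the transversely holomorphic coordinates $z^i=y^i+\sqrt{-1}\,dy^i$, and the normal Kähler metric $g^N=\sum_{i,j}(g_{ij}\circ\pi)\,dz^i\,d\bar z^j$ on the normal bundle of $\mathcal F_N$. Let $\mathbf R^N$ be the normal Ricci tensor of $g^N$, i.e. the Ricci tensor of the metric induced by $g^N$ on the local transverse manifolds of $\mathcal F_N$,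 extended complex bilinearly, and put $$\mathbf R^N_{ij}=\mathbf R^N\!\left(\frac{\partial}{\partial z^i},\frac{\partial}{\partial\bar z^j}\right),\qquad \frac{\partial}{\partial z^i}=\tfrac12\Big(\frac{\partial}{\partial y^i}-\sqrt{-1}\frac{\partial}{\partial (dy^i)}\Big),\quad \frac{\partial}{\partial \bar z^j}=\tfrac12\Big(\frac{\partial}{\partial y^j}+\sqrt{-1}\frac{\partial}{\partial (dy^j)}\Big).$$ Let $\omega=\sqrt{\det(g_{ij})}\,dy^1\wedge\cdots\wedge dy^q$ be the normal volume form of $g$ (locally defined up to sign), let $\alpha$ be the first normal Koszul form, defined by $D_X\omega=\alpha(X)\,\omega$, and let $\beta=D\alpha$ be the second normal Koszul form, with components $\beta_{ij}=(D_{\partial/\partial y^i}\alpha)(\overline{\partial/\partial y^j})$. Then in any adapted foliated affine coordinate system $(x^1,\dots,x^p,y^1,\dots,y^q)$ with domain $U$, for all $i,j=1,\dots,q$, $$\mathbf R^N_{ij}=-\tfrac12\,\beta_{ij}\circ\pi\qquad\text{on }\pi^{-1}(U).$$ -/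

import Mathlib

open Bundle Set
open scoped Manifold ContDiff Topology

namespace TransverselyHessian

noncomputable section

variable {E : Type*} [NormedAddCommGroup E] [NormedSpace ℝ E] {H : Type*} [TopologicalSpace H]
  {I : ModelWithCorners ℝ E H} {M : Type*} [TopologicalSpace M] [ChartedSpace H M]
  {p : ℕ} {ι : Type*} [Fintype ι]

variable (I M p ι) in
/-- Smooth local coordinate systems `(x, y)` on `M`, with `x ∈ ℝᵖ` and `y ∈ ℝ^ι`. -/
abbrev SplitChart : Type _ :=
  PartialDiffeomorph I 𝓘(ℝ, (Fin p → ℝ) × (ι → ℝ)) M ((Fin p → ℝ) × (ι → ℝ)) ∞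

/-- The differential `(dx, dy)` of a coordinate system at a point. -/
def SplitChart.d (φ : SplitChart I M p ι) (m : M) :
    TangentSpace I m →L[ℝ] (Fin p → ℝ) × (ι → ℝ) :=
  mvfderiv I φ.toFun m

/-- A coordinate system `(x, y)` is adapted to a field `T` of tangent subspaces
if `T = ker dy` on its domain. -/
def IsAdapted (T : ∀ m : M, Submodule ℝ (TangentSpace I m)) (φ : SplitChart I M p ι) : Prop :=
  ∀ m ∈ φ.source, ∀ v : TangentSpace I m, v ∈ T m ↔ (φ.d m v).2 = 0

variable (I M p ι) in
/-- A smooth foliation with leaves of dimension `p` and codimension `#ι`. -/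
structure Foliation where
  tangent : ∀ m : M, Submodule ℝ (TangentSpace I m)
  exists_adapted : ∀ m : M, ∃ φ : SplitChart I M p ι, m ∈ φ.source ∧ IsAdapted tangent φ

/-- Adapted charts `(x¹, …, xᵖ, y¹, …, y^q)` of a foliated manifold. -/
structure AdaptedChart (F : Foliation I M p ι) where
  chart : SplitChart I M p ι
  adapted : IsAdapted F.tangent chart

namespace Foliation

variable (F : Foliation I M p ι)

/-- The fibre `T_m M / T_m F` of the normal bundle of the foliation. -/
def Normal (m : M) : Type _ := TangentSpace I m ⧸ F.tangent m

instance (m : M) : AddCommGroup (F.Normal m) :=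
  inferInstanceAs (AddCommGroup (TangentSpace I m ⧸ F.tangent m))
instance (m : M) : Module ℝ (F.Normal m) :=
  inferInstanceAs (Module ℝ (TangentSpace I m ⧸ F.tangent m))
instance (m : M) : TopologicalSpace (F.Normal m) :=
  inferInstanceAs (TopologicalSpace (TangentSpace I m ⧸ F.tangent m))
instance (m : M) : IsTopologicalAddGroup (F.Normal m) :=
  inferInstanceAs (IsTopologicalAddGroup (TangentSpace I m ⧸ F.tangent m))
instance (m : M) : ContinuousSMul ℝ (F.Normal m) :=
  inferInstanceAs (ContinuousSMul ℝ (TangentSpace I m ⧸ F.tangent m))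

/-- The projection `v ↦ v̄` of tangent vectors to the normal bundle. -/
def bar (m : M) : TangentSpace I m →ₗ[ℝ] F.Normal m := (F.tangent m).mkQ

end Foliation
variable {F : Foliation I M p ι}

open Classical in
/-- The linear map on the normal space induced by a linear map `A` on the tangent space that
vanishes along the leaf (and `0` if `A` does not vanish along the leaf). -/
def Foliation.descend {W : Type*} [AddCommGroup W] [Module ℝ W] (F : Foliation I M p ι) (m : M)
    (A : TangentSpace I m →ₗ[ℝ] W) : F.Normal m →ₗ[ℝ] W :=
  if h : F.tangent m ≤ LinearMap.ker A then (F.tangent m).liftQ A h else 0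

theorem Foliation.descend_bar {W : Type*} [AddCommGroup W] [Module ℝ W] (F : Foliation I M p ι)
    (m : M) (A : TangentSpace I m →ₗ[ℝ] W) (h : ∀ v ∈ F.tangent m, A v = 0)
    (v : TangentSpace I m) : F.descend m A (F.bar m v) = A v := by
  have h' : F.tangent m ≤ LinearMap.ker A := fun v hv => h v hv
  have e : F.descend m A = (F.tangent m).liftQ A h' := dif_pos h'
  rw [e]
  exact Submodule.liftQ_apply _ _ _

theorem Foliation.bar_surjective (m : M) : Function.Surjective (F.bar m) :=
  Submodule.mkQ_surjective _

theorem Foliation.bar_eq_zero (m : M) (v : TangentSpace I m) : F.bar m v = 0 ↔ v ∈ F.tangent m :=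
  Submodule.Quotient.mk_eq_zero _

theorem SplitChart.exists_equiv [IsManifold I ∞ M] (φ : SplitChart I M p ι) {m : M} (hm : m ∈ φ.source) :
    ∃ L : TangentSpace I m ≃L[ℝ] (Fin p → ℝ) × (ι → ℝ),
      (L : TangentSpace I m →L[ℝ] (Fin p → ℝ) × (ι → ℝ)) = φ.d m := by
  refine ⟨((PartialDiffeomorph.isLocalDiffeomorphAt I _ ∞ φ hm).mfderivToContinuousLinearEquiv (by simp)).trans
    (NormedSpace.fromTangentSpace _), ?_⟩
  ext1 v
  rfl

namespace AdaptedChart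
variable (φ : AdaptedChart F)

/-- The forms `(dy¹, …, dy^q)` on the normal space. -/
def dy (m : M) : F.Normal m →ₗ[ℝ] (ι → ℝ) :=
  F.descend m ((LinearMap.snd ℝ _ _).comp (φ.chart.d m).toLinearMap)

/-- The normal vector with given values of `dy¹, …, dy^q`. -/
def ofDy (m : M) (w : ι → ℝ) : F.Normal m := F.bar m ((φ.chart.d m).inverse (0, w))

theorem dy_bar {m : M} (hm : m ∈ φ.chart.source) (v : TangentSpace I m) :
    φ.dy m (F.bar m v) = (φ.chart.d m v).2 :=
  F.descend_bar m _ (fun v hv => (φ.adapted m hm v).1 hv) v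

theorem d_inverse [IsManifold I ∞ M] {m : M} (hm : m ∈ φ.chart.source) (z : (Fin p → ℝ) × (ι → ℝ)) :
    φ.chart.d m ((φ.chart.d m).inverse z) = z := by
  obtain ⟨L, hL⟩ := φ.chart.exists_equiv hm
  rw [← hL]; simp

theorem dy_ofDy [IsManifold I ∞ M] {m : M} (hm : m ∈ φ.chart.source) (w : ι → ℝ) : φ.dy m (φ.ofDy m w) = w := by
  rw [ofDy, φ.dy_bar hm, φ.d_inverse hm]

theorem dy_injective {m : M} (hm : m ∈ φ.chart.source) : Function.Injective (φ.dy m) := by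
  rw [injective_iff_map_eq_zero]
  intro n hn
  obtain ⟨v, rfl⟩ := F.bar_surjective m n
  rw [φ.dy_bar hm] at hn
  exact (F.bar_eq_zero m v).2 ((φ.adapted m hm v).2 hn)

theorem ofDy_dy [IsManifold I ∞ M] {m : M} (hm : m ∈ φ.chart.source) (n : F.Normal m) : φ.ofDy m (φ.dy m n) = n :=
  φ.dy_injective hm (φ.dy_ofDy hm _)

/-- `dy` as a pretrivialization of the normal bundle. -/
def pretriv [IsManifold I ∞ M] : Pretrivialization (ι → ℝ) (π (ι → ℝ) F.Normal) where
  toFun ξ := (ξ.1, φ.dy ξ.1 ξ.2)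
  invFun z := ⟨z.1, φ.ofDy z.1 z.2⟩
  source := π (ι → ℝ) F.Normal ⁻¹' φ.chart.source
  target := φ.chart.source ×ˢ univ
  map_source' ξ h := ⟨h, mem_univ _⟩
  map_target' z h := h.1
  left_inv' ξ h := by
    obtain ⟨m, n⟩ := ξ
    simp only
    rw [φ.ofDy_dy h]
  right_inv' z h := by
    obtain ⟨m, w⟩ := z
    simp only
    rw [φ.dy_ofDy h.1]
  open_target := φ.chart.open_source.prod isOpen_univ
  baseSet := φ.chart.source
  open_baseSet := φ.chart.open_source
  source_eq := rfl
  target_eq := rfl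
  proj_toFun _ _ := rfl

theorem pretriv_symm [IsManifold I ∞ M] {m : M} (hm : m ∈ φ.chart.source) (w : ι → ℝ) :
    φ.pretriv.symm m w = φ.ofDy m w := by
  rw [Pretrivialization.symm_apply _ hm]
  rfl

/-- Change of coordinates from `φ` to `ψ`. -/
def change (φ ψ : AdaptedChart F) (z : (Fin p → ℝ) × (ι → ℝ)) : (Fin p → ℝ) × (ι → ℝ) :=
  ψ.chart.toFun (φ.chart.invFun z)

/-- The domain of the change of coordinates from `φ` to `ψ`. -/
def changeDomain (φ ψ : AdaptedChart F) : Set ((Fin p → ℝ) × (ι → ℝ)) :=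
  φ.chart.target ∩ φ.chart.invFun ⁻¹' ψ.chart.source

theorem isOpen_changeDomain (φ ψ : AdaptedChart F) : IsOpen (changeDomain φ ψ) :=
  φ.chart.contMDiffOn_invFun.continuousOn.isOpen_inter_preimage φ.chart.open_target
    ψ.chart.open_source

theorem mem_changeDomain (φ ψ : AdaptedChart F) {m : M} (h : m ∈ φ.chart.source)
    (h' : m ∈ ψ.chart.source) : φ.chart.toFun m ∈ changeDomain φ ψ :=
  ⟨φ.chart.map_source h, by
    rw [mem_preimage]; convert h'; exact φ.chart.left_inv h⟩

theorem contDiffOn_change (φ ψ : AdaptedChart F) :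
    ContDiffOn ℝ ∞ (change φ ψ) (changeDomain φ ψ) := by
  rw [← contMDiffOn_iff_contDiffOn]
  exact ψ.chart.contMDiffOn_toFun.comp (φ.chart.contMDiffOn_invFun.mono inter_subset_left)
    (fun z hz => hz.2)

theorem differentiableAt_change (φ ψ : AdaptedChart F) {z} (hz : z ∈ changeDomain φ ψ) :
    DifferentiableAt ℝ (change φ ψ) z :=
  ((contDiffOn_change φ ψ).contDiffAt ((isOpen_changeDomain φ ψ).mem_nhds hz)).differentiableAt
    (by simp)

theorem d_change (φ ψ : AdaptedChart F) {m : M} (h : m ∈ φ.chart.source)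
    (h' : m ∈ ψ.chart.source) (v : TangentSpace I m) :
    ψ.chart.d m v = fderiv ℝ (change φ ψ) (φ.chart.toFun m) (φ.chart.d m v) := by
  have hz := mem_changeDomain φ ψ h h'
  have e : ψ.chart.toFun =ᶠ[𝓝 m] change φ ψ ∘ φ.chart.toFun := by
    filter_upwards [φ.chart.open_source.mem_nhds h] with x hx
    simp only [change, Function.comp]
    congr 1
    exact (φ.chart.left_inv hx).symm
  have h1 : MDifferentiableAt I 𝓘(ℝ, (Fin p → ℝ) × (ι → ℝ)) φ.chart.toFun m :=
    φ.chart.mdifferentiableAt (by simp) h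
  have h2 : MDifferentiableAt 𝓘(ℝ, (Fin p → ℝ) × (ι → ℝ)) 𝓘(ℝ, (Fin p → ℝ) × (ι → ℝ))
      (change φ ψ) (φ.chart.toFun m) :=
    (differentiableAt_change φ ψ hz).mdifferentiableAt
  have h3 : HasMFDerivAt I 𝓘(ℝ, (Fin p → ℝ) × (ι → ℝ)) ψ.chart.toFun m _ :=
    (h2.hasMFDerivAt.comp m h1.hasMFDerivAt).congr_of_eventuallyEq e
  have h4 := h3.mfderiv
  rw [mfderiv_eq_fderiv] at h4
  change mfderiv I 𝓘(ℝ, (Fin p → ℝ) × (ι → ℝ)) ψ.chart.toFun m v = _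
  rw [h4]
  rfl

theorem fderiv_change_inl [IsManifold I ∞ M] (φ ψ : AdaptedChart F) {z : (Fin p → ℝ) × (ι → ℝ)}
    (hz : z ∈ changeDomain φ ψ) (u : Fin p → ℝ) : (fderiv ℝ (change φ ψ) z (u, 0)).2 = 0 := by
  have h1 : φ.chart.invFun z ∈ φ.chart.source := φ.chart.map_target hz.1
  have h2 : φ.chart.toFun (φ.chart.invFun z) = z := φ.chart.right_inv hz.1
  have := d_change φ ψ h1 hz.2 ((φ.chart.d _).inverse (u, 0))
  rw [φ.d_inverse h1, h2] at this
  rw [← this]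
  refine (ψ.adapted _ hz.2 _).1 ((φ.adapted _ h1 _).2 ?_)
  rw [φ.d_inverse h1]

/-- The linear change of normal coordinates. -/
def changeL (φ ψ : AdaptedChart F) (m : M) : (ι → ℝ) →L[ℝ] (ι → ℝ) :=
  (ContinuousLinearMap.snd ℝ _ _).comp
    ((fderiv ℝ (change φ ψ) (φ.chart.toFun m)).comp (ContinuousLinearMap.inr ℝ _ _))

theorem contMDiffOn_changeL (φ ψ : AdaptedChart F) :
    ContMDiffOn I 𝓘(ℝ, (ι → ℝ) →L[ℝ] (ι → ℝ)) ∞ (changeL φ ψ)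
      (φ.chart.source ∩ ψ.chart.source) := by
  have h1 : ContDiffOn ℝ ∞ (fun z => (ContinuousLinearMap.snd ℝ (Fin p → ℝ) (ι → ℝ)).comp
    ((fderiv ℝ (change φ ψ) z).comp (ContinuousLinearMap.inr ℝ (Fin p → ℝ) (ι → ℝ))))
      (changeDomain φ ψ) :=
    contDiffOn_const.clm_comp
      (((contDiffOn_change φ ψ).fderiv_of_isOpen (isOpen_changeDomain φ ψ) (by simp)).clm_comp
        contDiffOn_const)
  exact h1.contMDiffOn.comp (φ.chart.contMDiffOn_toFun.mono inter_subset_left)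
    (fun m hm => mem_changeDomain φ ψ hm.1 hm.2)

theorem changeL_apply [IsManifold I ∞ M] (φ ψ : AdaptedChart F) {m : M} (h : m ∈ φ.chart.source)
    (h' : m ∈ ψ.chart.source) (w : ι → ℝ) : changeL φ ψ m w = ψ.dy m (φ.ofDy m w) := by
  rw [ofDy, ψ.dy_bar h', d_change φ ψ h h', φ.d_inverse h]
  rfl

theorem isInducing_dy [IsManifold I ∞ M] {m : M} (hm : m ∈ φ.chart.source) :
    Topology.IsInducing (φ.dy m) := by
  have hc : Continuous (φ.dy m) := by
    refine (isQuotientMap_quotient_mk' (s := (F.tangent m).quotientRel)).continuous_iff.2 ?_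
    exact ((continuous_snd.comp (φ.chart.d m).continuous)).congr
      (fun v => (φ.dy_bar hm v).symm)
  have hd : Continuous (φ.ofDy m) :=
    (continuous_quot_mk.comp ((φ.chart.d m).inverse.continuous)).comp (Continuous.prodMk_right 0)
  refine Topology.IsInducing.of_comp hc hd ?_
  have e : φ.ofDy m ∘ φ.dy m = id := funext (φ.ofDy_dy hm)
  rw [e]
  exact Topology.IsInducing.id

end AdaptedChart

namespace Foliation
variable (F : Foliation I M p ι)

/-- An adapted chart around a given point. -/
def chartAt (m : M) : AdaptedChart F :=
  ⟨(F.exists_adapted m).choose, (F.exists_adapted m).choose_spec.2⟩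

theorem mem_chartAt (m : M) : m ∈ (F.chartAt m).chart.source :=
  (F.exists_adapted m).choose_spec.1

variable [IsManifold I ∞ M]

/-- The normal bundle `N(M, F)`, trivialized by the forms `dy` of the adapted charts. -/
def prebundle : VectorPrebundle ℝ (ι → ℝ) F.Normal where
  pretrivializationAtlas := range fun φ : AdaptedChart F => φ.pretriv
  pretrivialization_linear' := by
    rintro _ ⟨φ, rfl⟩
    exact ⟨fun m _ => (φ.dy m).isLinear⟩
  pretrivializationAt m := (F.chartAt m).pretriv
  mem_base_pretrivializationAt m := F.mem_chartAt m
  pretrivialization_mem_atlas m := ⟨_, rfl⟩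
  exists_coordChange := by
    rintro _ ⟨φ, rfl⟩ _ ⟨ψ, rfl⟩
    refine ⟨AdaptedChart.changeL φ ψ, (AdaptedChart.contMDiffOn_changeL φ ψ).continuousOn, ?_⟩
    rintro m ⟨h, h'⟩ w
    rw [φ.pretriv_symm h, AdaptedChart.changeL_apply φ ψ h h']
    rfl
  totalSpaceMk_isInducing m := by
    have h := (F.chartAt m).isInducing_dy (F.mem_chartAt m)
    have h2 : Topology.IsInducing fun w : ι → ℝ => (m, w) := isInducing_prodMkRight m
    exact h2.comp h

instance : TopologicalSpace (TotalSpace (ι → ℝ) F.Normal) := F.prebundle.totalSpaceTopology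
instance : FiberBundle (ι → ℝ) F.Normal := F.prebundle.toFiberBundle
instance : VectorBundle ℝ (ι → ℝ) F.Normal := F.prebundle.toVectorBundle
instance : F.prebundle.IsContMDiff I ∞ where
  exists_contMDiffCoordChange := by
    rintro _ ⟨φ, rfl⟩ _ ⟨ψ, rfl⟩
    refine ⟨AdaptedChart.changeL φ ψ, AdaptedChart.contMDiffOn_changeL φ ψ, ?_⟩
    rintro m ⟨h, h'⟩ w
    rw [φ.pretriv_symm h, AdaptedChart.changeL_apply φ ψ h h']
    rfl
instance : ContMDiffVectorBundle ∞ (ι → ℝ) F.Normal I := F.prebundle.contMDiffVectorBundle I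
end Foliation
namespace AdaptedChart
variable [IsManifold I ∞ M] (φ : AdaptedChart F)

/-- `dy` as a trivialization of the normal bundle. -/
def triv : Trivialization (ι → ℝ) (π (ι → ℝ) F.Normal) :=
  F.prebundle.trivializationOfMemPretrivializationAtlas ⟨φ, rfl⟩

instance : MemTrivializationAtlas φ.triv := ⟨⟨φ.pretriv, ⟨φ, rfl⟩, rfl⟩⟩

theorem contMDiffOn_dy :
    ContMDiffOn (I.prod 𝓘(ℝ, ι → ℝ)) 𝓘(ℝ, ι → ℝ) ∞
      (fun ξ : TotalSpace (ι → ℝ) F.Normal => φ.dy ξ.1 ξ.2)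
      (π (ι → ℝ) F.Normal ⁻¹' φ.chart.source) :=
  contMDiffOn_snd.comp (Trivialization.contMDiffOn (IB := I) (n := ∞) φ.triv)
    (t := univ) (fun _ _ => mem_univ _)

theorem contMDiffOn_ofDy :
    ContMDiffOn (I.prod 𝓘(ℝ, ι → ℝ)) (I.prod 𝓘(ℝ, ι → ℝ)) ∞
      (fun z : M × (ι → ℝ) => (⟨z.1, φ.ofDy z.1 z.2⟩ : TotalSpace (ι → ℝ) F.Normal))
      (φ.chart.source ×ˢ univ) :=
  Trivialization.contMDiffOn_symm (IB := I) (n := ∞) φ.triv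

/-- The chart `(x, y, dy)` of the normal bundle induced by an adapted chart `(x, y)`; the transverse
coordinates `(y, dy)` are indexed by `ι ⊕ ι`. -/
def normalSplit : SplitChart (I.prod 𝓘(ℝ, ι → ℝ)) (TotalSpace (ι → ℝ) F.Normal) p (ι ⊕ ι) where
  toFun ξ := ((φ.chart.toFun ξ.1).1, Sum.elim (φ.chart.toFun ξ.1).2 (φ.dy ξ.1 ξ.2))
  invFun z :=
    ⟨φ.chart.invFun (z.1, z.2 ∘ Sum.inl), φ.ofDy (φ.chart.invFun (z.1, z.2 ∘ Sum.inl)) (z.2 ∘ Sum.inr)⟩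
  source := π (ι → ℝ) F.Normal ⁻¹' φ.chart.source
  target := {z | (z.1, z.2 ∘ Sum.inl) ∈ φ.chart.target}
  map_source' ξ h := φ.chart.map_source h
  map_target' z h := φ.chart.map_target h
  left_inv' := by
    rintro ⟨m, n⟩ h
    have e : φ.chart.invFun (φ.chart.toFun m) = m := φ.chart.left_inv h
    simp only [Sum.elim_comp_inl, Sum.elim_comp_inr]
    rw [e, φ.ofDy_dy h]
  right_inv' := by
    rintro ⟨x, c⟩ h
    have e : φ.chart.toFun (φ.chart.invFun (x, c ∘ Sum.inl)) = (x, c ∘ Sum.inl) :=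
      φ.chart.right_inv h
    have e2 := φ.dy_ofDy (φ.chart.map_target h) (c ∘ Sum.inr)
    simp only [e]
    refine Prod.ext rfl ?_
    refine Eq.trans (congrArg (Sum.elim (c ∘ Sum.inl)) e2) ?_
    exact Sum.elim_comp_inl_inr c
  open_source := φ.chart.open_source.preimage (FiberBundle.continuous_proj (ι → ℝ) F.Normal)
  open_target := φ.chart.open_target.preimage (by fun_prop)
  contMDiffOn_toFun := by
    have h1 : ContMDiffOn (I.prod 𝓘(ℝ, ι → ℝ)) 𝓘(ℝ, (Fin p → ℝ) × (ι → ℝ)) ∞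
        (fun ξ : TotalSpace (ι → ℝ) F.Normal => φ.chart.toFun ξ.1)
        (π (ι → ℝ) F.Normal ⁻¹' φ.chart.source) :=
      φ.chart.contMDiffOn_toFun.comp (contMDiff_proj F.Normal).contMDiffOn (fun _ h => h)
    have h2 := h1.prodMk_space φ.contMDiffOn_dy
    have h3 : ContDiff ℝ ∞ fun w : ((Fin p → ℝ) × (ι → ℝ)) × (ι → ℝ) =>
        ((w.1.1, Sum.elim w.1.2 w.2) : (Fin p → ℝ) × (ι ⊕ ι → ℝ)) := by
      refine contDiff_fst.fst.prodMk (contDiff_pi.2 ?_)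
      rintro (a | a) <;> simp <;> fun_prop
    exact h3.contMDiff.comp_contMDiffOn h2
  contMDiffOn_invFun := by
    have h1 : ContDiff ℝ ∞ fun z : (Fin p → ℝ) × (ι ⊕ ι → ℝ) => (z.1, z.2 ∘ Sum.inl) := by
      refine contDiff_fst.prodMk (contDiff_pi.2 ?_)
      intro a; simp; fun_prop
    have h2 : ContDiff ℝ ∞ fun z : (Fin p → ℝ) × (ι ⊕ ι → ℝ) => z.2 ∘ Sum.inr := by
      refine contDiff_pi.2 ?_
      intro a; simp; fun_prop
    have h3 : ContMDiffOn 𝓘(ℝ, (Fin p → ℝ) × (ι ⊕ ι → ℝ)) I ∞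
        (fun z : (Fin p → ℝ) × (ι ⊕ ι → ℝ) => φ.chart.invFun (z.1, z.2 ∘ Sum.inl))
        {z | (z.1, z.2 ∘ Sum.inl) ∈ φ.chart.target} :=
      ContMDiffOn.comp φ.chart.contMDiffOn_invFun h1.contMDiff.contMDiffOn (fun z hz => hz)
    exact φ.contMDiffOn_ofDy.comp (h3.prodMk h2.contMDiff.contMDiffOn)
      (fun z h => ⟨φ.chart.map_target h, mem_univ _⟩)

theorem exists_transverse_change (φ ψ : AdaptedChart F) {z₀ : (Fin p → ℝ) × (ι → ℝ)}
    (hz : z₀ ∈ changeDomain φ ψ) : ∃ τ : (ι → ℝ) → (ι → ℝ), ContDiffAt ℝ ∞ τ z₀.2 ∧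
      ∀ᶠ z in 𝓝 z₀, (change φ ψ z).2 = τ z.2 := by
  refine ⟨fun y => (change φ ψ (z₀.1, y)).2, ?_, ?_⟩
  · have h1 : ContDiffAt ℝ ∞ (change φ ψ) (z₀.1, z₀.2) :=
      (contDiffOn_change φ ψ).contDiffAt ((isOpen_changeDomain φ ψ).mem_nhds hz)
    exact (h1.comp z₀.2 (contDiffAt_const.prodMk contDiffAt_id)).snd
  · obtain ⟨r, hr, hB⟩ := Metric.isOpen_iff.1 (isOpen_changeDomain φ ψ) z₀ hz
    filter_upwards [Metric.ball_mem_nhds z₀ hr] with z hzB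
    rw [← ball_prod_same] at hB
    have hzB' : z ∈ Metric.ball z₀.1 r ×ˢ Metric.ball z₀.2 r := by
      rw [ball_prod_same]; exact hzB
    have hd : ∀ a ∈ Metric.ball z₀.1 r, HasFDerivAt (fun a => (change φ ψ (a, z.2)).2)
        (0 : (Fin p → ℝ) →L[ℝ] (ι → ℝ)) a := by
      intro a ha
      have hm : (a, z.2) ∈ changeDomain φ ψ := hB ⟨ha, hzB'.2⟩
      have h0 := HasFDerivAt.comp (g := change φ ψ) (f := fun a => (a, z.2)) a
        (differentiableAt_change φ ψ hm).hasFDerivAt (hasFDerivAt_prodMk_left a z.2)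
      have h1 := HasFDerivAt.snd (f₂ := change φ ψ ∘ fun a => (a, z.2)) h0
      refine HasFDerivAt.congr_fderiv h1 ?_
      ext1 u
      exact fderiv_change_inl φ ψ hm u
    exact (convex_ball z₀.1 r).is_const_of_fderivWithin_eq_zero (𝕜 := ℝ)
      (f := fun a => (change φ ψ (a, z.2)).2)
      (fun a ha => (hd a ha).differentiableAt.differentiableWithinAt)
      (fun a ha => by
        rw [fderivWithin_of_isOpen Metric.isOpen_ball ha]; exact (hd a ha).fderiv)
      hzB'.1 (Metric.mem_ball_self hr)

/-- Locally the transverse coordinates `(y, dy)` of one induced chart are functions of those of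
another. -/
theorem normalSplit_d_eq_zero (φ ψ : AdaptedChart F) {ξ : TotalSpace (ι → ℝ) F.Normal}
    (h : ξ.1 ∈ φ.chart.source) (h' : ξ.1 ∈ ψ.chart.source)
    (v : TangentSpace (I.prod 𝓘(ℝ, ι → ℝ)) ξ) (hv : (φ.normalSplit.d ξ v).2 = 0) :
    (ψ.normalSplit.d ξ v).2 = 0 := by
  obtain ⟨τ, hτ, hev⟩ := exists_transverse_change φ ψ (mem_changeDomain φ ψ h h')
  let J := I.prod 𝓘(ℝ, ι → ℝ)
  let K : (ι ⊕ ι → ℝ) → (ι ⊕ ι → ℝ) := fun c =>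
    Sum.elim (τ (c ∘ Sum.inl)) (fderiv ℝ τ (c ∘ Sum.inl) (c ∘ Sum.inr))
  let θ : TotalSpace (ι → ℝ) F.Normal → (ι ⊕ ι → ℝ) := fun ζ => (φ.normalSplit.toFun ζ).2
  have hφ : MDifferentiableAt J 𝓘(ℝ, (Fin p → ℝ) × (ι ⊕ ι → ℝ)) φ.normalSplit.toFun ξ :=
    PartialDiffeomorph.mdifferentiableAt φ.normalSplit (by simp) h
  have hψ : MDifferentiableAt J 𝓘(ℝ, (Fin p → ℝ) × (ι ⊕ ι → ℝ)) ψ.normalSplit.toFun ξ :=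
    PartialDiffeomorph.mdifferentiableAt ψ.normalSplit (by simp) h'
  have hK : DifferentiableAt ℝ K (θ ξ) := by
    have e1 : θ ξ ∘ Sum.inl = (φ.chart.toFun ξ.1).2 := Sum.elim_comp_inl _ _
    have hl : DifferentiableAt ℝ (fun c : ι ⊕ ι → ℝ => c ∘ Sum.inl) (θ ξ) := by
      refine differentiableAt_pi.2 fun a => ?_
      simp only [Function.comp]; fun_prop
    have hr : DifferentiableAt ℝ (fun c : ι ⊕ ι → ℝ => c ∘ Sum.inr) (θ ξ) := by
      refine differentiableAt_pi.2 fun a => ?_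
      simp only [Function.comp]; fun_prop
    have h1 : DifferentiableAt ℝ (fun c : ι ⊕ ι → ℝ => τ (c ∘ Sum.inl)) (θ ξ) := by
      refine DifferentiableAt.comp (θ ξ) ?_ hl
      rw [e1]; exact hτ.differentiableAt (by simp)
    have h2 : DifferentiableAt ℝ (fun c : ι ⊕ ι → ℝ => fderiv ℝ τ (c ∘ Sum.inl)) (θ ξ) := by
      refine DifferentiableAt.comp (g := fderiv ℝ τ) (θ ξ) ?_ hl
      rw [e1]
      exact (hτ.fderiv_right (m := 1) (by norm_cast)).differentiableAt (by simp)
    have h3 := h2.clm_apply hr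
    refine differentiableAt_pi.2 ?_
    rintro (a | a)
    · exact differentiableAt_pi.1 h1 a
    · exact differentiableAt_pi.1 h3 a
  have hθ : HasMFDerivAt J 𝓘(ℝ, ι ⊕ ι → ℝ) θ ξ
      ((ContinuousLinearMap.snd ℝ (Fin p → ℝ) (ι ⊕ ι → ℝ)).comp (φ.normalSplit.d ξ)) :=
    (ContinuousLinearMap.snd ℝ (Fin p → ℝ) (ι ⊕ ι → ℝ)).hasMFDerivAt.comp ξ hφ.hasMFDerivAt
  have hθ' : HasMFDerivAt J 𝓘(ℝ, ι ⊕ ι → ℝ) (fun ζ => (ψ.normalSplit.toFun ζ).2) ξ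
      ((ContinuousLinearMap.snd ℝ (Fin p → ℝ) (ι ⊕ ι → ℝ)).comp (ψ.normalSplit.d ξ)) :=
    (ContinuousLinearMap.snd ℝ (Fin p → ℝ) (ι ⊕ ι → ℝ)).hasMFDerivAt.comp ξ hψ.hasMFDerivAt
  have e : (fun ζ => (ψ.normalSplit.toFun ζ).2) =ᶠ[𝓝 ξ] K ∘ θ := by
    have hc : ContinuousAt (fun ζ : TotalSpace (ι → ℝ) F.Normal => φ.chart.toFun ζ.1) ξ :=
      ContinuousAt.comp (g := φ.chart.toFun)
        (φ.chart.contMDiffOn_toFun.continuousOn.continuousAt (φ.chart.open_source.mem_nhds h))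
        (FiberBundle.continuous_proj (ι → ℝ) F.Normal).continuousAt
    filter_upwards [hc.eventually hev.eventually_nhds, φ.normalSplit.open_source.mem_nhds h,
      ψ.normalSplit.open_source.mem_nhds h'] with ζ hζ hs hs'
    have hs1 : ζ.1 ∈ φ.chart.source := hs
    have hs2 : ζ.1 ∈ ψ.chart.source := hs'
    have y1 : (ψ.chart.toFun ζ.1).2 = τ (φ.chart.toFun ζ.1).2 := by
      rw [← hζ.self_of_nhds]
      simp only [change]
      congr 2
      exact (φ.chart.left_inv hs1).symm
    have y2 : ψ.dy ζ.1 ζ.2 = fderiv ℝ τ (φ.chart.toFun ζ.1).2 (φ.dy ζ.1 ζ.2) := by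
      have a1 := changeL_apply φ ψ hs1 hs2 (φ.dy ζ.1 ζ.2)
      rw [φ.ofDy_dy hs1] at a1
      have b0 := HasFDerivAt.comp (g := change φ ψ)
        (f := fun y => ((φ.chart.toFun ζ.1).1, y)) (φ.chart.toFun ζ.1).2
        (differentiableAt_change φ ψ (mem_changeDomain φ ψ hs1 hs2)).hasFDerivAt
        (hasFDerivAt_prodMk_right _ _)
      have b1 := HasFDerivAt.snd
        (f₂ := change φ ψ ∘ fun y => ((φ.chart.toFun ζ.1).1, y)) b0
      have b2 : (fun y => (change φ ψ ((φ.chart.toFun ζ.1).1, y)).2) =ᶠ[𝓝 (φ.chart.toFun ζ.1).2]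
          τ := (Continuous.prodMk_right (φ.chart.toFun ζ.1).1).continuousAt.eventually hζ
      rw [(b1.congr_of_eventuallyEq b2.symm).fderiv]
      exact a1.symm
    change Sum.elim _ _ = Sum.elim _ _
    rw [y1, y2]
    rfl
  have hKθ := (hK.hasFDerivAt.hasMFDerivAt.comp ξ hθ).congr_of_eventuallyEq e
  have := hasMFDerivAt_unique hθ' hKθ
  have e2 := congrArg (fun A => A v) this
  refine e2.trans ?_
  change fderiv ℝ K (θ ξ) ((φ.normalSplit.d ξ v).2) = 0
  rw [hv, map_zero]

end AdaptedChart

/-- The foliation `F_N` of the total space of the normal bundle: it has codimension `2 #ι` and its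
leaves are locally given by `y = const`, `dy = const`. -/
def Foliation.lift [IsManifold I ∞ M] (F : Foliation I M p ι) :
    Foliation (I.prod 𝓘(ℝ, ι → ℝ)) (TotalSpace (ι → ℝ) F.Normal) p (ι ⊕ ι) where
  tangent ξ := LinearMap.ker ((LinearMap.snd ℝ _ _).comp
    ((F.chartAt ξ.1).normalSplit.d ξ).toLinearMap)
  exists_adapted ξ := by
    refine ⟨(F.chartAt ξ.1).normalSplit, F.mem_chartAt ξ.1, fun ζ hζ v => ⟨fun h => ?_, fun h => ?_⟩⟩
    · exact AdaptedChart.normalSplit_d_eq_zero _ _ (F.mem_chartAt ζ.1) hζ v h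
    · exact AdaptedChart.normalSplit_d_eq_zero _ _ hζ (F.mem_chartAt ζ.1) v h

/-- The adapted chart `(x, y, dy)` of `(N(M, F), F_N)` induced by an adapted chart `(x, y)` of
`(M, F)`. -/
def AdaptedChart.lift [IsManifold I ∞ M] (φ : AdaptedChart F) : AdaptedChart F.lift where
  chart := φ.normalSplit
  adapted ζ hζ v := by
    refine ⟨fun h => ?_, fun h => ?_⟩
    · exact AdaptedChart.normalSplit_d_eq_zero _ _ (F.mem_chartAt ζ.1) hζ v h
    · exact AdaptedChart.normalSplit_d_eq_zero _ _ hζ (F.mem_chartAt ζ.1) v h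

/-! ### Coordinate formulas for the Ricci curvature -/

section Coordinates

variable {κ : Type*} [Fintype κ] [DecidableEq κ]

/-- The partial derivative `∂f/∂yⁱ`. -/
def pderiv (i : κ) (f : (κ → ℝ) → ℝ) (y : κ → ℝ) : ℝ := fderiv ℝ f y (Pi.single i 1)

/-- The Christoffel symbols `Γᵏᵢⱼ` of a metric given in coordinates by the matrix `h`. -/
def christoffel (h : (κ → ℝ) → Matrix κ κ ℝ) (k i j : κ) (y : κ → ℝ) : ℝ :=
  1 / 2 * ∑ s, (h y)⁻¹ k s *
    (pderiv i (fun z => h z s j) y + pderiv j (fun z => h z s i) y - pderiv s (fun z => h z i j) y)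

/-- The components `Ric(∂ⱼ, ∂ₖ) = tr (X ↦ R(X, ∂ⱼ)∂ₖ)` of the Ricci tensor of a metric given in
coordinates by the matrix `h`, where `R(X, Y) = ∇_X ∇_Y - ∇_Y ∇_X - ∇_[X, Y]`. -/
def ricciCoord (h : (κ → ℝ) → Matrix κ κ ℝ) (y : κ → ℝ) (j k : κ) : ℝ :=
  ∑ i, (pderiv i (christoffel h i j k) y - pderiv j (christoffel h i i k) y +
    ∑ l, (christoffel h i i l y * christoffel h l j k y -
      christoffel h i j l y * christoffel h l i k y))

end Coordinates

variable [DecidableEq ι]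

namespace AdaptedChart

/-- The coordinate vector field `∂/∂yᵃ`. -/
def coordVec (φ : AdaptedChart F) (a : ι) (m : M) : TangentSpace I m :=
  (φ.chart.d m).inverse (0, Pi.single a 1)

/-- The class of `∂/∂yᵃ` in the normal bundle. -/
def frame (φ : AdaptedChart F) (a : ι) (m : M) : F.Normal m := F.bar m (φ.coordVec a m)

/-- The components in the coordinates of `φ` of the normal Ricci tensor of a field `G` of scalar
products on the normal bundle of a foliation, at the point `m`. This is the Ricci tensor of the
metric `∑ G(∂ₐ, ∂_b) dyᵃ dyᵇ` on the local transverse manifold, parametrized by `y`. -/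
def normalRicci (φ : AdaptedChart F) (G : ∀ m, F.Normal m → F.Normal m → ℝ) (m : M) (a b : ι) : ℝ :=
  ricciCoord (fun y => Matrix.of fun a b =>
      let m' := φ.chart.invFun ((φ.chart.toFun m).1, y)
      G m' (φ.frame a m') (φ.frame b m'))
    (φ.chart.toFun m).2 a b

end AdaptedChart

variable [IsManifold I ∞ M]

/-! ### Transversely Hessian foliations -/

/-- `φ` is an affine coordinate system for the connection `D` in the normal bundle:
the sections `∂/∂yⱼ` are `D`-parallel. -/
def IsAffineChart (D : CovariantDerivative I (ι → ℝ) F.Normal) (φ : AdaptedChart F) : Prop :=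
  ∀ m ∈ φ.chart.source, ∀ j, D (φ.frame j) m = 0

/-- `D` is a foliated flat torsion-free connection in the normal bundle, i.e. it makes the
foliation transversely affine. -/
structure IsFlatFoliated (D : CovariantDerivative I (ι → ℝ) F.Normal) : Prop where
  smooth : CovariantDerivative.ContMDiffCovariantDerivative D ∞
  /-- In adapted charts, `D_X ∂ⱼ = ∑ dyⁱ(X) Γᵏᵢⱼ ∂ₖ` with `Γ` a function of the transverse
  coordinates only. -/
  foliated : ∀ φ : AdaptedChart F, ∀ m ∈ φ.chart.source, ∃ Γ : (ι → ℝ) → ι → ι → ι → ℝ,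
    ∀ᶠ m' in 𝓝 m, ∀ (v : TangentSpace I m') (j : ι), D (φ.frame j) m' v =
      ∑ i, ∑ k, ((φ.chart.d m' v).2 i * Γ (φ.chart.toFun m').2 i j k) • φ.frame k m'
  torsion_free : ∀ X Y : ∀ m : M, TangentSpace I m,
    ContMDiff I I.tangent ∞ (fun m => (⟨m, X m⟩ : TangentBundle I M)) →
    ContMDiff I I.tangent ∞ (fun m => (⟨m, Y m⟩ : TangentBundle I M)) →
    ∀ m, D (fun m => F.bar m (Y m)) m (X m) - D (fun m => F.bar m (X m)) m (Y m) =
      F.bar m (VectorField.mlieBracket I X Y m)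
  flat : ∀ (X Y : ∀ m : M, TangentSpace I m) (s : ∀ m, F.Normal m),
    ContMDiff I I.tangent ∞ (fun m => (⟨m, X m⟩ : TangentBundle I M)) →
    ContMDiff I I.tangent ∞ (fun m => (⟨m, Y m⟩ : TangentBundle I M)) →
    ContMDiff I (I.prod 𝓘(ℝ, ι → ℝ)) ∞ (fun m => (⟨m, s m⟩ : TotalSpace (ι → ℝ) F.Normal)) →
    ∀ m, D (fun m => D s m (Y m)) m (X m) - D (fun m => D s m (X m)) m (Y m) -
      D s m (VectorField.mlieBracket I X Y m) = 0

/-- The components `gᵢⱼ` of a metric of the normal bundle in an adapted chart. -/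
def AdaptedChart.gram (φ : AdaptedChart F) (g : ContMDiffRiemannianMetric I ∞ (ι → ℝ) F.Normal)
    (m : M) : Matrix ι ι ℝ :=
  Matrix.of fun i j => g.inner m (φ.frame i m) (φ.frame j m)

/-- `(D, g)` is a transversely Hessian structure of the foliation: `D` makes the foliation
transversely affine and, in adapted affine coordinates, locally
`gᵢⱼ = ∂²h/∂yⁱ∂yʲ` for a smooth basic function `h`. -/
structure IsTransverselyHessian (D : CovariantDerivative I (ι → ℝ) F.Normal)
    (g : ContMDiffRiemannianMetric I ∞ (ι → ℝ) F.Normal) : Prop where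
  flat : IsFlatFoliated D
  hessian : ∀ φ : AdaptedChart F, IsAffineChart D φ → ∀ m ∈ φ.chart.source,
    ∃ (W : Set (ι → ℝ)) (h : (ι → ℝ) → ℝ), IsOpen W ∧ (φ.chart.toFun m).2 ∈ W ∧
      ContDiffOn ℝ ∞ h W ∧
      ∀ᶠ m' in 𝓝 m, ∀ i j, φ.gram g m' i j = pderiv i (pderiv j h) (φ.chart.toFun m').2

/-! ### The Koszul forms -/

/-- The normal volume form `ω = √(det gᵢⱼ) dy¹ ∧ ⋯ ∧ dy^q` of `g` on the domain of `φ`, for the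
orientation given by `φ`. -/
def AdaptedChart.volumeForm (φ : AdaptedChart F)
    (g : ContMDiffRiemannianMetric I ∞ (ι → ℝ) F.Normal) (m : M) : F.Normal m [⋀^ι]→ₗ[ℝ] ℝ :=
  Real.sqrt (φ.gram g m).det • (Matrix.detRowAlternating (n := ι) (R := ℝ)).compLinearMap (φ.dy m)

/-- The covariant derivative
`(D_X Ω)(s₁, …, s_q) = X(Ω(s₁, …, s_q)) - ∑ₖ Ω(s₁, …, D_X sₖ, …, s_q)`
of a normal form of degree `q`, as a function of `X`. -/
def covDerivVolume (D : CovariantDerivative I (ι → ℝ) F.Normal)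
    (Ω : ∀ m, F.Normal m [⋀^ι]→ₗ[ℝ] ℝ) (s : ι → ∀ m, F.Normal m) (m : M) :
    TangentSpace I m →ₗ[ℝ] ℝ :=
  (mvfderiv I (fun m' => Ω m' fun i => s i m') m).toLinearMap -
    ∑ k, ((Ω m).toMultilinearMap.toLinearMap (fun i => s i m) k).comp (D (s k) m).toLinearMap

/-- The first normal Koszul form `α`, determined by `D_X ω = α(X) ω` (an identity between
forms of top degree, hence equivalent to its evaluation on the frame `∂₁, …, ∂_q`). As `α`
vanishes along the leaves it is a form on the normal bundle. -/
def AdaptedChart.firstKoszulForm (φ : AdaptedChart F) (D : CovariantDerivative I (ι → ℝ) F.Normal)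
    (g : ContMDiffRiemannianMetric I ∞ (ι → ℝ) F.Normal) (m : M) : F.Normal m →ₗ[ℝ] ℝ :=
  F.descend m ((φ.volumeForm g m fun i => φ.frame i m)⁻¹ •
    covDerivVolume D (φ.volumeForm g) φ.frame m)

/-- The covariant derivative `(D_v α)(s) = v(α(s)) - α(D_v s)` of a 1-form of the normal bundle. -/
def covDerivForm (D : CovariantDerivative I (ι → ℝ) F.Normal) (α : ∀ m, F.Normal m →ₗ[ℝ] ℝ)
    (m : M) (v : TangentSpace I m) (s : ∀ m, F.Normal m) : ℝ :=
  mvfderiv I (fun m' => α m' (s m')) m v - α m (D s m v)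

/-- The components `βᵢⱼ = (D_{∂ᵢ} α)(∂ⱼ)` of the second normal Koszul form `β = Dα`. -/
def AdaptedChart.secondKoszulForm (φ : AdaptedChart F) (D : CovariantDerivative I (ι → ℝ) F.Normal)
    (g : ContMDiffRiemannianMetric I ∞ (ι → ℝ) F.Normal) (m : M) (i j : ι) : ℝ :=
  covDerivForm D (φ.firstKoszulForm D g) m (φ.coordVec i m) (φ.frame j)

/-! ### The Kähler metric of the normal bundle -/

/-- The forms `dzⁱ` of the transversely holomorphic coordinates `zⁱ = yⁱ + √-1 dyⁱ` on the normal
bundle. -/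
def AdaptedChart.dz (φ : AdaptedChart F) (ξ : TotalSpace (ι → ℝ) F.Normal) (i : ι)
    (u : F.lift.Normal ξ) : ℂ :=
  ⟨φ.lift.dy ξ u (Sum.inl i), φ.lift.dy ξ u (Sum.inr i)⟩

open Classical in
/-- The normal metric `g^N = ∑ (gᵢⱼ ∘ π) dzⁱ dz̄ʲ` of `(N(M, F), F_N)`, in any adapted affine
coordinate system around the base point. -/
def kahlerMetric (D : CovariantDerivative I (ι → ℝ) F.Normal)
    (g : ContMDiffRiemannianMetric I ∞ (ι → ℝ) F.Normal) (ξ : TotalSpace (ι → ℝ) F.Normal)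
    (u w : F.lift.Normal ξ) : ℝ :=
  if h : ∃ φ : AdaptedChart F, ξ.1 ∈ φ.chart.source ∧ IsAffineChart D φ then
    (∑ i, ∑ j, (h.choose.gram g ξ.1 i j : ℂ) *
      (h.choose.dz ξ i u * (starRingEnd ℂ) (h.choose.dz ξ j w))).re
  else 0

/-- The component `R(∂/∂zⁱ, ∂/∂z̄ʲ)` of the complex bilinear extension of a real bilinear form with
components `R` in the real coordinates `(y, dy)`, where `∂/∂zⁱ = ½ (∂/∂yⁱ - √-1 ∂/∂(dyⁱ))` and
`∂/∂z̄ʲ = ½ (∂/∂yʲ + √-1 ∂/∂(dyʲ))`. -/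
def hermitianComponent (R : ι ⊕ ι → ι ⊕ ι → ℝ) (i j : ι) : ℂ :=
  1 / 4 * ((R (Sum.inl i) (Sum.inl j) : ℂ) + Complex.I * R (Sum.inl i) (Sum.inr j) -
    Complex.I * R (Sum.inr i) (Sum.inl j) + R (Sum.inr i) (Sum.inr j))

end

end TransverselyHessian

/-! In affine transverse coordinates the metric is a Hessian, so `∂ₖ gᵢⱼ` is symmetric in all three
indices (the Codazzi equation). This has two consequences. The Christoffel symbols reduce to `γᵏᵢⱼ =
½ gᵏˢ ∂ₛ gᵢⱼ`, and Jacobi's formula gives `∂ⱼ log √(det g) = ∑ₖ γᵏₖⱼ`. Since the frame `∂ⱼ` is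
parallel, `α` and `β` are obtained by plain differentiation: `αⱼ = ∑ₖ γᵏₖⱼ` and `βᵢⱼ = ∂ᵢ ∑ₖ γᵏₖⱼ`.

In the coordinates `(y, w)` with `w = dy`, the Kähler metric is block diagonal with two equal blocks
`g(y)`. Up to sign its nonzero Christoffel symbols are again `γ` (`christoffel_doubleMetric`). In
the Ricci tensor the mixed `y`-`w` components vanish. In the sum of the `yy` and `ww` components the
divergence terms and all quadratic terms cancel, which leaves `-2 ∂ᵢ ∑ₖ γᵏₖⱼ`
(`ricciCoord_doubleMetric_add`). The factor `1/4` from `∂/∂zⁱ` and `∂/∂z̄ʲ` turns this into `-½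
βᵢⱼ`.

It remains to see that the block form holds in the given affine chart, although `kahlerMetric` uses
an arbitrarily chosen one at each point. The transition matrix between affine charts has zero
differential, because it relates two parallel frames (`hasMFDerivAt_changeL`). Hence `y`- and
`w`-differentials transform by the same real matrix and the metric is independent of the choice
(`kahlerMetric_eq`). -/

namespace TransverselyHessian

/-! ### Coordinate calculus: locality, symmetry of second derivatives, Jacobi's formula. -/

section Coordinates

variable {κ : Type*} [DecidableEq κ]

theorem pderiv_congr {f g : (κ → ℝ) → ℝ} {y : κ → ℝ} (h : f =ᶠ[𝓝 y] g) (i : κ) :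
    pderiv i f y = pderiv i g y := by
  rw [pderiv, pderiv, h.fderiv_eq]

variable [Fintype κ]

theorem christoffel_eventuallyEq {h h' : (κ → ℝ) → Matrix κ κ ℝ} {y : κ → ℝ} (e : h =ᶠ[𝓝 y] h')
    (k i j : κ) : christoffel h k i j =ᶠ[𝓝 y] christoffel h' k i j := by
  have e' : ∀ a b, (fun z => h z a b) =ᶠ[𝓝 y] fun z => h' z a b :=
    fun a b => e.mono fun z hz => by simp only [hz]
  filter_upwards [e.eventuallyEq_nhds] with z hz
  have hz' : ∀ a b, (fun z => h z a b) =ᶠ[𝓝 z] fun z => h' z a b :=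
    fun a b => hz.mono fun z hz => by simp only [hz]
  simp only [christoffel, hz.self_of_nhds, pderiv_congr (hz' _ _)]

/-- Curvature depends only on the germ of the metric. This is needed because the gram matrix of a
foliated metric is known as a function of `y` only near a given point. -/
theorem ricciCoord_congr {h h' : (κ → ℝ) → Matrix κ κ ℝ} {y : κ → ℝ} (e : h =ᶠ[𝓝 y] h') :
    ricciCoord h y = ricciCoord h' y := by
  funext j k
  simp only [ricciCoord, pderiv_congr (christoffel_eventuallyEq e _ _ _),
    (christoffel_eventuallyEq e _ _ _).self_of_nhds]

theorem contDiffOn_pderiv {f : (κ → ℝ) → ℝ} {U : Set (κ → ℝ)} (hU : IsOpen U)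
    (hf : ContDiffOn ℝ ∞ f U) (i : κ) : ContDiffOn ℝ ∞ (pderiv i f) U :=
  (hf.fderiv_of_isOpen hU (by simp)).clm_apply contDiffOn_const

theorem pderiv_comm {f : (κ → ℝ) → ℝ} {U : Set (κ → ℝ)} (hU : IsOpen U)
    (hf : ContDiffOn ℝ ∞ f U) {y : κ → ℝ} (hy : y ∈ U) (i j : κ) :
    pderiv i (pderiv j f) y = pderiv j (pderiv i f) y := by
  have hs : IsSymmSndFDerivAt ℝ f y :=
    (hf.contDiffAt (hU.mem_nhds hy)).isSymmSndFDerivAt (by simpa using ENat.LEInfty.out)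
  have hd : DifferentiableAt ℝ (fderiv ℝ f) y :=
    ((hf.fderiv_of_isOpen hU (m := ∞) (by simp)).contDiffAt
      (hU.mem_nhds hy)).differentiableAt (by simp)
  have h : ∀ a b : κ, pderiv a (pderiv b f) y =
      fderiv ℝ (fderiv ℝ f) y (Pi.single a 1) (Pi.single b 1) := by
    intro a b
    have := (hd.hasFDerivAt.clm_apply (hasFDerivAt_const (Pi.single b (1 : ℝ)) y)).fderiv
    rw [pderiv]
    unfold pderiv
    rw [this]
    simp
  rw [h, h]
  exact hs _ _

/-- Jacobi's formula. -/
theorem hasFDerivAt_det {V : Type*} [NormedAddCommGroup V] [NormedSpace ℝ V]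
    {G : V → Matrix κ κ ℝ} {G' : κ → κ → V →L[ℝ] ℝ} {y : V}
    (hG : ∀ i j, HasFDerivAt (fun z => G z i j) (G' i j) y) :
    HasFDerivAt (fun z => (G z).det) (∑ i, ∑ j, (G y).adjugate j i • G' i j) y := by
  let d : ContinuousMultilinearMap ℝ (fun _ : κ => κ → ℝ) ℝ :=
    { (Matrix.detRowAlternating (n := κ) (R := ℝ)).toMultilinearMap with
      cont := Continuous.matrix_det continuous_id }
  have h := HasFDerivAt.multilinear_comp (f := d) (g := fun i z => G z i)
    (g' := fun i => ContinuousLinearMap.pi (G' i)) (x := y)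
    (fun i => hasFDerivAt_pi.2 fun j => hG i j)
  refine h.congr_fderiv ?_
  ext v
  simp only [FunLike.coe_sum, Finset.sum_apply, ContinuousLinearMap.comp_apply,
    smul_apply, smul_eq_mul]
  refine Finset.sum_congr rfl fun i _ => ?_
  -- The `i`-th term of the multilinear derivative is the determinant with row `i` differentiated;
  -- Cramer's rule expands it along that row.
  change ((G y).updateRow i fun j => G' i j v).det = _
  rw [← Matrix.cramer_transpose_apply, Matrix.cramer_eq_adjugate_mulVec,
    ← Matrix.adjugate_transpose]
  rfl

variable {ι : Type*} [Fintype ι] [DecidableEq ι]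

theorem pderiv_comp_inl {f : (ι → ℝ) → ℝ} {c : ι ⊕ ι → ℝ}
    (hf : DifferentiableAt ℝ f (c ∘ Sum.inl)) (a : ι ⊕ ι) :
    pderiv a (fun c => f (c ∘ Sum.inl)) c =
      Sum.elim (fun i => pderiv i f (c ∘ Sum.inl)) (fun _ => 0) a := by
  let P : (ι ⊕ ι → ℝ) →L[ℝ] (ι → ℝ) := ContinuousLinearMap.pi fun i => ContinuousLinearMap.proj (Sum.inl i)
  have h : HasFDerivAt (fun c => f (c ∘ Sum.inl)) ((fderiv ℝ f (c ∘ Sum.inl)).comp P) c :=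
    HasFDerivAt.comp (g := f) (f := P) c hf.hasFDerivAt P.hasFDerivAt
  rw [pderiv, h.fderiv]
  rcases a with a | a
  · simp only [Sum.elim_inl, pderiv, ContinuousLinearMap.comp_apply]
    congr 1
    ext i
    simp [P, Pi.single_apply]
  · simp only [Sum.elim_inr, ContinuousLinearMap.comp_apply]
    have h0 : P (Pi.single (Sum.inr a) 1) = 0 := by ext i; simp [P]
    rw [h0, map_zero]

/-- A matrix function `G` that is a nondegenerate Hessian-type metric on the open set `U`: it is
smooth, symmetric, invertible and satisfies the Codazzi equation. -/
structure IsCodazziMetricOn (G : (ι → ℝ) → Matrix ι ι ℝ) (U : Set (ι → ℝ)) : Prop where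
  isOpen : IsOpen U
  smooth : ∀ i j, ContDiffOn ℝ ∞ (fun y => G y i j) U
  det_ne_zero : ∀ y ∈ U, (G y).det ≠ 0
  symm : ∀ y ∈ U, ∀ i j, G y i j = G y j i
  codazzi : ∀ y ∈ U, ∀ i j k,
    pderiv k (fun z => G z i j) y = pderiv i (fun z => G z k j) y

/-- The metric `∑ Gᵢⱼ(y) (dyⁱ dyʲ + dwⁱ dwʲ)` in the coordinates `(y, w)`. -/
def doubleMetric (G : (ι → ℝ) → Matrix ι ι ℝ) (c : ι ⊕ ι → ℝ) : Matrix (ι ⊕ ι) (ι ⊕ ι) ℝ :=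
  Matrix.fromBlocks (G (c ∘ Sum.inl)) 0 0 (G (c ∘ Sum.inl))

/-! ### Curvature of a Codazzi metric and of its double. -/

namespace IsCodazziMetricOn

variable {G : (ι → ℝ) → Matrix ι ι ℝ} {U : Set (ι → ℝ)}

theorem differentiableAt (hG : IsCodazziMetricOn G U) {y : ι → ℝ} (hy : y ∈ U) (i j : ι) :
    DifferentiableAt ℝ (fun y => G y i j) y :=
  ((hG.smooth i j).contDiffAt (hG.isOpen.mem_nhds hy)).differentiableAt (by simp)

theorem pderiv_symm (hG : IsCodazziMetricOn G U) {y : ι → ℝ} (hy : y ∈ U) (i j k : ι) :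
    pderiv k (fun z => G z i j) y = pderiv k (fun z => G z j i) y :=
  pderiv_congr (Filter.mem_of_superset (hG.isOpen.mem_nhds hy) fun z hz => hG.symm z hz i j) k

/-- By the Codazzi equation the three derivatives in the Christoffel symbol are equal, so two of
them cancel. -/
theorem christoffel_eq (hG : IsCodazziMetricOn G U) {y : ι → ℝ} (hy : y ∈ U) (k i j : ι) :
    christoffel G k i j y = 1 / 2 * ∑ s, (G y)⁻¹ k s * pderiv s (fun z => G z i j) y := by
  rw [christoffel]
  congr 1
  refine Finset.sum_congr rfl fun s _ => ?_
  rw [hG.codazzi y hy s j i, hG.codazzi y hy s i j, hG.pderiv_symm hy j i s]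
  ring

theorem contDiffOn_det (hG : IsCodazziMetricOn G U) : ContDiffOn ℝ ∞ (fun y => (G y).det) U := by
  simp only [Matrix.det_apply]
  exact ContDiffOn.sum fun σ _ => (contDiffOn_prod fun i _ => hG.smooth _ _).const_smul _

theorem contDiffOn_inv (hG : IsCodazziMetricOn G U) (i j : ι) :
    ContDiffOn ℝ ∞ (fun y => (G y)⁻¹ i j) U := by
  -- Cramer's rule makes each entry of the inverse a quotient of determinants, hence smooth where
  -- `det G ≠ 0`.
  have h : ∀ y, (G y)⁻¹ i j = ((G y).det)⁻¹ * ((G y).updateRow j (Pi.single i 1)).det := by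
    intro y
    rw [Matrix.inv_def, Matrix.smul_apply, Matrix.adjugate_apply, Ring.inverse_eq_inv', smul_eq_mul]
  simp only [h]
  refine (hG.contDiffOn_det.inv hG.det_ne_zero).mul ?_
  simp only [Matrix.det_apply]
  refine ContDiffOn.sum fun σ _ => (contDiffOn_prod fun k _ => ?_).const_smul _
  simp only [Matrix.updateRow_apply]
  split_ifs
  · exact contDiffOn_const
  · exact hG.smooth _ _

theorem contDiffOn_christoffel (hG : IsCodazziMetricOn G U) (k i j : ι) :
    ContDiffOn ℝ ∞ (christoffel G k i j) U := by
  have h : ∀ a b c, ContDiffOn ℝ ∞ (pderiv a (fun z => G z b c)) U :=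
    fun a b c => contDiffOn_pderiv hG.isOpen (hG.smooth b c) a
  unfold christoffel
  exact contDiffOn_const.mul (ContDiffOn.sum fun s _ => (hG.contDiffOn_inv k s).mul
    (((h _ _ _).add (h _ _ _)).sub (h _ _ _)))

theorem differentiableAt_christoffel (hG : IsCodazziMetricOn G U) {y : ι → ℝ} (hy : y ∈ U)
    (k i j : ι) : DifferentiableAt ℝ (christoffel G k i j) y :=
  ((hG.contDiffOn_christoffel k i j).contDiffAt (hG.isOpen.mem_nhds hy)).differentiableAt (by simp)

theorem inv_doubleMetric (hG : IsCodazziMetricOn G U) {c : ι ⊕ ι → ℝ} (hc : c ∘ Sum.inl ∈ U) :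
    (doubleMetric G c)⁻¹ = Matrix.fromBlocks (G (c ∘ Sum.inl))⁻¹ 0 0 (G (c ∘ Sum.inl))⁻¹ := by
  have h : IsUnit (G (c ∘ Sum.inl)).det := (hG.det_ne_zero _ hc).isUnit
  refine Matrix.inv_eq_right_inv ?_
  simp [doubleMetric, Matrix.fromBlocks_multiply, Matrix.mul_nonsing_inv _ h]

/-- The Christoffel symbols of the double of a Codazzi metric. -/
def doubleChristoffel (γ : ι → ι → ι → ℝ) : ι ⊕ ι → ι ⊕ ι → ι ⊕ ι → ℝ
  | Sum.inl k, Sum.inl i, Sum.inl j => γ k i j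
  | Sum.inl k, Sum.inr i, Sum.inr j => -γ k i j
  | Sum.inr k, Sum.inl i, Sum.inr j => γ k i j
  | Sum.inr k, Sum.inr i, Sum.inl j => γ k i j
  | _, _, _ => 0

/-- The blocks do not depend on the fibre coordinates, so a symbol survives only with an even number
of fibre indices. With two lower fibre indices only the subtracted term `-∂ₛ Gᵢⱼ` remains, hence the
minus sign; in the other cases the Codazzi equation brings the result to the form of
`christoffel_eq`. -/
theorem christoffel_doubleMetric (hG : IsCodazziMetricOn G U) {c : ι ⊕ ι → ℝ}
    (hc : c ∘ Sum.inl ∈ U) (k i j : ι ⊕ ι) :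
    christoffel (doubleMetric G) k i j c =
      doubleChristoffel (fun k i j => christoffel G k i j (c ∘ Sum.inl)) k i j := by
  have h0 : ∀ a : ι ⊕ ι, pderiv a (fun _ : ι ⊕ ι → ℝ => (0 : ℝ)) c = 0 := by
    intro a; simp [pderiv]
  have h1 : ∀ (a : ι ⊕ ι) (i j : ι), pderiv a (fun z : ι ⊕ ι → ℝ => G (z ∘ Sum.inl) i j) c =
      Sum.elim (fun k => pderiv k (fun z => G z i j) (c ∘ Sum.inl)) (fun _ => 0) a :=
    fun a i j => pderiv_comp_inl (hG.differentiableAt hc i j) a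
  have e1 : ∀ s i j, pderiv i (fun z => G z s j) (c ∘ Sum.inl) =
      pderiv s (fun z => G z i j) (c ∘ Sum.inl) := fun s i j => hG.codazzi _ hc _ _ _
  have e2 : ∀ s i j, pderiv j (fun z => G z s i) (c ∘ Sum.inl) =
      pderiv s (fun z => G z i j) (c ∘ Sum.inl) := fun s i j => by
    rw [hG.codazzi _ hc s i j, hG.pderiv_symm hc]
  rw [christoffel, hG.inv_doubleMetric hc]
  rcases k with k | k <;> rcases i with i | i <;> rcases j with j | j <;>
    simp [doubleChristoffel, doubleMetric, Fintype.sum_sum_type, h0, h1, hG.christoffel_eq hc] <;>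
    refine Finset.sum_congr rfl fun s _ => ?_
  -- The pure base symbol keeps all three derivatives; the two symbols with fibre upper index keep
  -- just one each.
  · rw [e1 s i j, e2 s i j, add_sub_cancel_right]
  · rw [e1 s i j]
  · rw [e2 s i j]

theorem pderiv_christoffel_doubleMetric (hG : IsCodazziMetricOn G U) {c : ι ⊕ ι → ℝ}
    (hc : c ∘ Sum.inl ∈ U) (a k i j : ι ⊕ ι) :
    pderiv a (christoffel (doubleMetric G) k i j) c =
      Sum.elim (fun a => doubleChristoffel
        (fun k i j => pderiv a (christoffel G k i j) (c ∘ Sum.inl)) k i j) (fun _ => 0) a := by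
  have hcont : Continuous fun c : ι ⊕ ι → ℝ => c ∘ Sum.inl := by fun_prop
  have e : christoffel (doubleMetric G) k i j =ᶠ[𝓝 c] fun c =>
      doubleChristoffel (fun k i j => christoffel G k i j (c ∘ Sum.inl)) k i j :=
    Filter.mem_of_superset ((hG.isOpen.preimage hcont).mem_nhds hc)
      fun z hz => hG.christoffel_doubleMetric hz k i j
  have h0 : pderiv a (fun _ : ι ⊕ ι → ℝ => (0 : ℝ)) c = 0 := by simp [pderiv]
  have h1 : ∀ k i j, pderiv a (fun z : ι ⊕ ι → ℝ => christoffel G k i j (z ∘ Sum.inl)) c =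
      Sum.elim (fun a => pderiv a (christoffel G k i j) (c ∘ Sum.inl)) (fun _ => 0) a :=
    fun k i j => pderiv_comp_inl (hG.differentiableAt_christoffel hc k i j) a
  have h2 : ∀ k i j, pderiv a (fun z : ι ⊕ ι → ℝ => -christoffel G k i j (z ∘ Sum.inl)) c =
      -Sum.elim (fun a => pderiv a (christoffel G k i j) (c ∘ Sum.inl)) (fun _ => 0) a := by
    intro k i j
    rw [← h1, pderiv, fderiv_fun_neg]
    rfl
  rw [pderiv_congr e]
  rcases k with k | k <;> rcases i with i | i <;> rcases j with j | j <;>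
    simp only [doubleChristoffel, h0, h1, h2] <;> rcases a with a | a <;> simp

/-- Passing from base to fibre indices `j`, `k` reverses the sign of the divergence term and of both
quadratic terms, so these cancel in the sum. The trace term `-∂ⱼ Γᵃₐₖ` occurs only for base indices,
as fibre derivatives vanish; the trace over base and fibre counts `γ` twice. -/
theorem ricciCoord_doubleMetric_add (hG : IsCodazziMetricOn G U) {c : ι ⊕ ι → ℝ}
    (hc : c ∘ Sum.inl ∈ U) (j k : ι) :
    ricciCoord (doubleMetric G) c (Sum.inl j) (Sum.inl k) +
        ricciCoord (doubleMetric G) c (Sum.inr j) (Sum.inr k) =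
      -2 * ∑ i, pderiv j (christoffel G i i k) (c ∘ Sum.inl) := by
  simp only [ricciCoord, hG.christoffel_doubleMetric hc, hG.pderiv_christoffel_doubleMetric hc,
    Fintype.sum_sum_type, doubleChristoffel, Sum.elim_inl, Sum.elim_inr]
  rw [← Finset.sum_add_distrib, ← Finset.sum_add_distrib, ← Finset.sum_add_distrib,
    Finset.mul_sum]
  refine Finset.sum_congr rfl fun i _ => ?_
  simp only [mul_zero, sub_zero, zero_sub, mul_neg, neg_mul, Finset.sum_sub_distrib,
    Finset.sum_neg_distrib, Finset.sum_const_zero, add_zero, zero_add]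
  ring

/-- With one free fibre index, every term contains either a fibre derivative or a Christoffel symbol
with an odd number of fibre indices. -/
theorem ricciCoord_doubleMetric_inl_inr (hG : IsCodazziMetricOn G U) {c : ι ⊕ ι → ℝ}
    (hc : c ∘ Sum.inl ∈ U) (j k : ι) :
    ricciCoord (doubleMetric G) c (Sum.inl j) (Sum.inr k) = 0 := by
  simp [ricciCoord, hG.christoffel_doubleMetric hc, hG.pderiv_christoffel_doubleMetric hc,
    Fintype.sum_sum_type, doubleChristoffel]

theorem ricciCoord_doubleMetric_inr_inl (hG : IsCodazziMetricOn G U) {c : ι ⊕ ι → ℝ}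
    (hc : c ∘ Sum.inl ∈ U) (j k : ι) :
    ricciCoord (doubleMetric G) c (Sum.inr j) (Sum.inl k) = 0 := by
  simp [ricciCoord, hG.christoffel_doubleMetric hc, hG.pderiv_christoffel_doubleMetric hc,
    Fintype.sum_sum_type, doubleChristoffel]

/-- The Hermitian components of the Ricci tensor of the double of a Codazzi metric. -/
theorem hermitianComponent_ricciCoord_doubleMetric (hG : IsCodazziMetricOn G U) {c : ι ⊕ ι → ℝ}
    (hc : c ∘ Sum.inl ∈ U) (i j : ι) :
    hermitianComponent (ricciCoord (doubleMetric G) c) i j =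
      ((-(1 / 2) * ∑ k, pderiv i (christoffel G k k j) (c ∘ Sum.inl) : ℝ) : ℂ) := by
  have h := hG.ricciCoord_doubleMetric_add hc i j
  rw [hermitianComponent, hG.ricciCoord_doubleMetric_inl_inr hc,
    hG.ricciCoord_doubleMetric_inr_inl hc]
  -- The constant is the `1/4` of `hermitianComponent` times the `-2` of the sum formula; the
  -- imaginary mixed terms are already gone.
  have h' : -(1 / 2) * ∑ k, pderiv i (christoffel G k k j) (c ∘ Sum.inl) =
      1 / 4 * (ricciCoord (doubleMetric G) c (Sum.inl i) (Sum.inl j) +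
        ricciCoord (doubleMetric G) c (Sum.inr i) (Sum.inr j)) := by
    rw [h]; ring
  rw [h']
  push_cast
  ring

/-- The logarithmic derivative of the volume density of a Codazzi metric. -/
theorem pderiv_sqrt_det (hG : IsCodazziMetricOn G U) {y : ι → ℝ} (hy : y ∈ U)
    (hpos : 0 < (G y).det) (j : ι) :
    pderiv j (fun y => Real.sqrt (G y).det) y =
      Real.sqrt (G y).det * ∑ k, christoffel G k k j y := by
  have h := (hasFDerivAt_det fun a b => (hG.differentiableAt hy a b).hasFDerivAt).sqrt hpos.ne'
  have hs : Real.sqrt (G y).det ≠ 0 := (Real.sqrt_pos.2 hpos).ne'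
  have hsq : Real.sqrt (G y).det * Real.sqrt (G y).det = (G y).det :=
    Real.mul_self_sqrt hpos.le
  have hadj : ∀ a b, (G y).adjugate a b = (G y).det * (G y)⁻¹ a b := by
    intro a b
    rw [Matrix.inv_def, Matrix.smul_apply, Ring.inverse_eq_inv', smul_eq_mul,
      mul_inv_cancel_left₀ hpos.ne']
  rw [pderiv, h.fderiv]
  simp only [smul_apply, FunLike.coe_sum, Finset.sum_apply, smul_eq_mul, hadj,
    hG.christoffel_eq hy, ← Finset.mul_sum, mul_assoc]
  rw [Finset.sum_comm]
  -- Jacobi's formula yields the trace of `G⁻¹ ∂ⱼ G`; the Codazzi equation moves the derivative onto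
  -- a contracted index, giving the contraction of `christoffel_eq`.
  have e : ∀ a b, fderiv ℝ (fun y => G y a b) y (Pi.single j 1) = pderiv a (fun z => G z b j) y := by
    intro a b
    change pderiv j _ y = _
    rw [hG.codazzi y hy a b j, hG.pderiv_symm hy]
  simp only [e]
  generalize ∑ a, ∑ b, (G y)⁻¹ a b * pderiv b (fun z => G z a j) y = S
  generalize Real.sqrt (G y).det = r at hs hsq ⊢
  rw [← hsq]
  field_simp

end IsCodazziMetricOn

end Coordinates

/-! ### The Koszul forms in an affine chart. -/

section Koszul

variable {E : Type*} [NormedAddCommGroup E] [NormedSpace ℝ E] {H : Type*} [TopologicalSpace H]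
  {I : ModelWithCorners ℝ E H} {M : Type*} [TopologicalSpace M] [ChartedSpace H M]
  {p : ℕ} {ι : Type*} [Fintype ι] {F : Foliation I M p ι}

namespace AdaptedChart

theorem continuousAt_toFun (φ : AdaptedChart F) {m : M} (hm : m ∈ φ.chart.source) :
    ContinuousAt φ.chart.toFun m :=
  φ.chart.contMDiffOn_toFun.continuousOn.continuousAt (φ.chart.open_source.mem_nhds hm)

/-- The differential of a function which is locally a function of the transverse coordinates. -/
theorem mvfderiv_basic (φ : AdaptedChart F) {m : M} (hm : m ∈ φ.chart.source)
    {f : M → ℝ} {f₀ : (ι → ℝ) → ℝ} (hf : f =ᶠ[𝓝 m] fun m' => f₀ (φ.chart.toFun m').2)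
    (hf₀ : DifferentiableAt ℝ f₀ (φ.chart.toFun m).2) (v : TangentSpace I m) :
    mvfderiv I f m v = fderiv ℝ f₀ (φ.chart.toFun m).2 (φ.chart.d m v).2 := by
  have h1 : MDifferentiableAt I 𝓘(ℝ, (Fin p → ℝ) × (ι → ℝ)) φ.chart.toFun m :=
    φ.chart.mdifferentiableAt (by simp) hm
  have h2 : HasFDerivAt (fun z : (Fin p → ℝ) × (ι → ℝ) => f₀ z.2)
      ((fderiv ℝ f₀ (φ.chart.toFun m).2).comp (ContinuousLinearMap.snd ℝ _ _))
      (φ.chart.toFun m) := HasFDerivAt.comp (g := f₀) _ hf₀.hasFDerivAt hasFDerivAt_snd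
  have h3 : HasMFDerivAt I 𝓘(ℝ, ℝ) f m _ :=
    (h2.hasMFDerivAt.comp m h1.hasMFDerivAt).congr_of_eventuallyEq hf
  change mfderiv I 𝓘(ℝ, ℝ) f m v = _
  rw [h3.mfderiv]
  rfl

variable [IsManifold I ∞ M] [DecidableEq ι]

theorem d_coordVec (φ : AdaptedChart F) {m : M} (hm : m ∈ φ.chart.source) (a : ι) :
    φ.chart.d m (φ.coordVec a m) = (0, Pi.single a 1) :=
  φ.d_inverse hm _

theorem dy_frame (φ : AdaptedChart F) {m : M} (hm : m ∈ φ.chart.source) (a : ι) :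
    φ.dy m (φ.frame a m) = Pi.single a 1 :=
  φ.dy_ofDy hm _

theorem sum_smul_frame (φ : AdaptedChart F) {m : M} (hm : m ∈ φ.chart.source) (w : ι → ℝ) :
    ∑ a, w a • φ.frame a m = φ.ofDy m w := by
  apply φ.dy_injective hm
  rw [φ.dy_ofDy hm, map_sum]
  simp only [map_smul, φ.dy_frame hm]
  ext i
  simp [Finset.sum_apply, Pi.single_apply]

theorem inner_ofDy (φ : AdaptedChart F) (g : ContMDiffRiemannianMetric I ∞ (ι → ℝ) F.Normal)
    {m : M} (hm : m ∈ φ.chart.source) (v w : ι → ℝ) :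
    g.inner m (φ.ofDy m v) (φ.ofDy m w) = ∑ i, ∑ j, φ.gram g m i j * (v i * w j) := by
  rw [← φ.sum_smul_frame hm, ← φ.sum_smul_frame hm]
  simp only [map_sum, map_smul, FunLike.coe_sum, Finset.sum_apply, smul_apply, smul_eq_mul,
    Finset.mul_sum, gram, Matrix.of_apply]
  rw [Finset.sum_comm]
  refine Finset.sum_congr rfl fun i _ => Finset.sum_congr rfl fun j _ => ?_
  ring

theorem gram_posDef (φ : AdaptedChart F) (g : ContMDiffRiemannianMetric I ∞ (ι → ℝ) F.Normal)
    {m : M} (hm : m ∈ φ.chart.source) : (φ.gram g m).PosDef := by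
  refine Matrix.PosDef.of_dotProduct_mulVec_pos ?_ fun x hx => ?_
  · ext i j
    simp [gram, g.symm m (φ.frame j m)]
  · have hne : φ.ofDy m x ≠ 0 := by
      intro h
      apply hx
      rw [← φ.dy_ofDy hm x, h, map_zero]
    have := g.pos m _ hne
    rw [φ.inner_ofDy g hm] at this
    refine this.trans_eq ?_
    simp only [dotProduct, Matrix.mulVec, Finset.mul_sum, star_trivial]
    refine Finset.sum_congr rfl fun i _ => Finset.sum_congr rfl fun j _ => ?_
    ring

/-- Locally the metric of a transversely Hessian structure is a Codazzi metric in the transverse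
coordinates of an affine chart. -/
theorem exists_codazziMetric {D : CovariantDerivative I (ι → ℝ) F.Normal}
    {g : ContMDiffRiemannianMetric I ∞ (ι → ℝ) F.Normal} (hDg : IsTransverselyHessian D g)
    (φ : AdaptedChart F) (hφ : IsAffineChart D φ) {m : M} (hm : m ∈ φ.chart.source) :
    ∃ (G : (ι → ℝ) → Matrix ι ι ℝ) (U : Set (ι → ℝ)), IsCodazziMetricOn G U ∧
      (∀ y ∈ U, 0 < (G y).det) ∧ (φ.chart.toFun m).2 ∈ U ∧
      ∀ᶠ m' in 𝓝 m, φ.gram g m' = G (φ.chart.toFun m').2 := by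
  obtain ⟨W, h, hW, hyW, hh, hev⟩ := hDg.hessian φ hφ m hm
  let G : (ι → ℝ) → Matrix ι ι ℝ := fun y => Matrix.of fun i j => pderiv i (pderiv j h) y
  have hG : ∀ i j, ContDiffOn ℝ ∞ (fun y => G y i j) W := fun i j =>
    contDiffOn_pderiv hW (contDiffOn_pderiv hW hh j) i
  have hdet : ContinuousOn (fun y => (G y).det) W := by
    simp only [Matrix.det_apply]
    exact continuousOn_finsetSum _ fun σ _ =>
      (continuousOn_finsetProd _ fun i _ => (hG _ _).continuousOn).const_smul _
  have hev' : ∀ᶠ m' in 𝓝 m, φ.gram g m' = G (φ.chart.toFun m').2 := by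
    filter_upwards [hev] with m' h'
    ext i j
    exact h' i j
  -- The domain of the potential is cut down to `det > 0`. The point itself survives since its gram
  -- matrix is positive definite. The Codazzi equation is the commutation of `∂ₖ` and `∂ᵢ` on `∂ⱼ
  -- h`.
  refine ⟨G, W ∩ (fun y => (G y).det) ⁻¹' Ioi 0, ⟨hdet.isOpen_inter_preimage hW isOpen_Ioi,
    fun i j => (hG i j).mono inter_subset_left, fun y hy => ne_of_gt hy.2,
    fun y hy i j => pderiv_comm hW hh hy.1 i j, fun y hy i j k => ?_⟩, fun y hy => hy.2,
    ⟨hyW, ?_⟩, hev'⟩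
  · exact pderiv_comm hW (contDiffOn_pderiv hW hh j) hy.1 k i
  · have := (φ.gram_posDef g hm).det_pos
    rwa [hev'.self_of_nhds] at this

theorem volumeForm_frame (φ : AdaptedChart F)
    (g : ContMDiffRiemannianMetric I ∞ (ι → ℝ) F.Normal) {m : M} (hm : m ∈ φ.chart.source) :
    (φ.volumeForm g m fun i => φ.frame i m) = Real.sqrt (φ.gram g m).det := by
  have h : (fun i => φ.dy m (φ.frame i m)) = (1 : Matrix ι ι ℝ) := by
    ext i j
    rw [φ.dy_frame hm, Pi.single_apply, Matrix.one_apply]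
    simp [eq_comm]
  have h2 : (Matrix.detRowAlternating (n := ι) (R := ℝ)) (fun i => φ.dy m (φ.frame i m)) = 1 := by
    rw [h]
    exact Matrix.det_one
  change Real.sqrt (φ.gram g m).det * (Matrix.detRowAlternating (n := ι) (R := ℝ))
    (fun i => φ.dy m (φ.frame i m)) = _
  rw [h2, mul_one]

/-- For a parallel frame, `D_X ω` evaluated on the frame is just `X(√det G)`, so `α(∂ⱼ)` is the
logarithmic derivative computed in `pderiv_sqrt_det`. -/
theorem firstKoszulForm_frame {D : CovariantDerivative I (ι → ℝ) F.Normal}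
    {g : ContMDiffRiemannianMetric I ∞ (ι → ℝ) F.Normal} {φ : AdaptedChart F}
    (hφ : IsAffineChart D φ) {m : M} (hm : m ∈ φ.chart.source)
    {G : (ι → ℝ) → Matrix ι ι ℝ} {U : Set (ι → ℝ)} (hG : IsCodazziMetricOn G U)
    (hpos : ∀ y ∈ U, 0 < (G y).det) (hmU : (φ.chart.toFun m).2 ∈ U)
    (he : ∀ᶠ m' in 𝓝 m, φ.gram g m' = G (φ.chart.toFun m').2) (j : ι) :
    φ.firstKoszulForm D g m (φ.frame j m) = ∑ k, christoffel G k k j (φ.chart.toFun m).2 := by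
  have hdpos := hpos _ hmU
  have hdiff : DifferentiableAt ℝ (fun y => Real.sqrt (G y).det) (φ.chart.toFun m).2 :=
    ((hG.contDiffOn_det.contDiffAt (hG.isOpen.mem_nhds hmU)).differentiableAt
      (by simp)).sqrt hdpos.ne'
  have hev : (fun m' => φ.volumeForm g m' fun i => φ.frame i m') =ᶠ[𝓝 m]
      fun m' => Real.sqrt (G (φ.chart.toFun m').2).det := by
    filter_upwards [he, φ.chart.open_source.mem_nhds hm] with m' h1 h2
    rw [φ.volumeForm_frame g h2, h1]
  have hcov : ∀ v, covDerivVolume D (φ.volumeForm g) φ.frame m v =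
      fderiv ℝ (fun y => Real.sqrt (G y).det) (φ.chart.toFun m).2 (φ.chart.d m v).2 := by
    intro v
    rw [← φ.mvfderiv_basic hm hev hdiff v]
    have h0 : ∀ k, D (φ.frame k) m = 0 := fun k => hφ m hm k
    simp [covDerivVolume, h0]
  -- `descend` has the default value `0` on maps not vanishing along the leaf, so this vanishing
  -- must be checked; it holds because `√det G` is basic.
  have hleaf : ∀ v ∈ F.tangent m, ((φ.volumeForm g m fun i => φ.frame i m)⁻¹ •
      covDerivVolume D (φ.volumeForm g) φ.frame m) v = 0 := by
    intro v hv
    rw [LinearMap.smul_apply, hcov, (φ.adapted m hm v).1 hv, map_zero, smul_zero]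
  rw [firstKoszulForm, frame, F.descend_bar m _ hleaf, LinearMap.smul_apply, hcov,
    φ.d_coordVec hm, φ.volumeForm_frame g hm, he.self_of_nhds, smul_eq_mul]
  have := hG.pderiv_sqrt_det hmU hdpos j
  rw [pderiv] at this
  rw [this, inv_mul_cancel_left₀ (Real.sqrt_pos.2 hdpos).ne']

/-- The term `α(D ∂ⱼ)` vanishes, so `βᵢⱼ` is the ordinary derivative of the component `αⱼ`. -/
theorem secondKoszulForm_eq {D : CovariantDerivative I (ι → ℝ) F.Normal}
    {g : ContMDiffRiemannianMetric I ∞ (ι → ℝ) F.Normal} {φ : AdaptedChart F}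
    (hφ : IsAffineChart D φ) {m : M} (hm : m ∈ φ.chart.source)
    {G : (ι → ℝ) → Matrix ι ι ℝ} {U : Set (ι → ℝ)} (hG : IsCodazziMetricOn G U)
    (hpos : ∀ y ∈ U, 0 < (G y).det) (hmU : (φ.chart.toFun m).2 ∈ U)
    (he : ∀ᶠ m' in 𝓝 m, φ.gram g m' = G (φ.chart.toFun m').2) (i j : ι) :
    φ.secondKoszulForm D g m i j =
      ∑ k, pderiv i (christoffel G k k j) (φ.chart.toFun m).2 := by
  have hev : (fun m' => φ.firstKoszulForm D g m' (φ.frame j m')) =ᶠ[𝓝 m]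
      fun m' => (fun y => ∑ k, christoffel G k k j y) (φ.chart.toFun m').2 := by
    -- The form `α` already involves a derivative of the metric, so at each nearby point the local
    -- expression of the gram matrix must hold on a whole neighbourhood.
    filter_upwards [he.eventually_nhds, φ.chart.open_source.mem_nhds hm,
      (φ.continuousAt_toFun hm).snd.eventually (hG.isOpen.mem_nhds hmU)] with m' h1 h2 h3
    exact firstKoszulForm_frame hφ h2 hG hpos h3 h1 j
  have hd : ∀ k, DifferentiableAt ℝ (christoffel G k k j) (φ.chart.toFun m).2 :=
    fun k => hG.differentiableAt_christoffel hmU k k j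
  rw [secondKoszulForm, covDerivForm, hφ m hm j,
    φ.mvfderiv_basic hm hev (DifferentiableAt.fun_sum fun k _ => hd k), φ.d_coordVec hm,
    fderiv_fun_sum fun k _ => hd k]
  simp [pderiv]

end AdaptedChart

end Koszul

/-! ### Independence of the affine chart, and the Ricci tensor of the Kähler metric. -/

section Kahler

variable {E : Type*} [NormedAddCommGroup E] [NormedSpace ℝ E] {H : Type*} [TopologicalSpace H]
  {I : ModelWithCorners ℝ E H} {M : Type*} [TopologicalSpace M] [ChartedSpace H M]
  {p : ℕ} {ι : Type*} [Fintype ι] {F : Foliation I M p ι} [IsManifold I ∞ M]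

/-- Additivity of `D` requires differentiable sections, so differentiability of the partial sums is
carried through the induction. -/
theorem covariantDerivative_sum {D : CovariantDerivative I (ι → ℝ) F.Normal} {κ : Type*}
    (s : Finset κ) {σ : κ → ∀ m, F.Normal m} {m : M}
    (hσ : ∀ k, MDifferentiableAt I (I.prod 𝓘(ℝ, ι → ℝ))
      (fun m => (⟨m, σ k m⟩ : TotalSpace (ι → ℝ) F.Normal)) m) :
    D (∑ k ∈ s, σ k) m = ∑ k ∈ s, D (σ k) m ∧
      MDifferentiableAt I (I.prod 𝓘(ℝ, ι → ℝ))
        (fun m => (⟨m, (∑ k ∈ s, σ k) m⟩ : TotalSpace (ι → ℝ) F.Normal)) m := by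
  classical
  induction s using Finset.induction_on with
  | empty =>
    refine ⟨by simp, ?_⟩
    exact mdifferentiableAt_zeroSection ℝ F.Normal
  | insert a s ha ih =>
    rw [Finset.sum_insert ha, Finset.sum_insert ha,
      D.isCovariantDerivativeOnUniv.add (hσ a) ih.2, ih.1]
    exact ⟨rfl, mdifferentiableAt_add_section (hσ a) ih.2⟩

namespace AdaptedChart

theorem ofDy_changeL (φ ψ : AdaptedChart F) {m : M} (h : m ∈ φ.chart.source)
    (h' : m ∈ ψ.chart.source) (w : ι → ℝ) : ψ.ofDy m (changeL φ ψ m w) = φ.ofDy m w := by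
  rw [changeL_apply φ ψ h h', ψ.ofDy_dy h']

variable [DecidableEq ι]

theorem contMDiffOn_frame (φ : AdaptedChart F) (a : ι) :
    ContMDiffOn I (I.prod 𝓘(ℝ, ι → ℝ)) ∞
      (fun m => (⟨m, φ.frame a m⟩ : TotalSpace (ι → ℝ) F.Normal)) φ.chart.source :=
  φ.contMDiffOn_ofDy.comp (f := fun m : M => (m, (Pi.single a 1 : ι → ℝ)))
    (contMDiff_id.prodMk contMDiff_const).contMDiffOn (fun _ hm => ⟨hm, mem_univ _⟩)

theorem mdifferentiableAt_frame (φ : AdaptedChart F) {m : M} (hm : m ∈ φ.chart.source) (a : ι) :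
    MDifferentiableAt I (I.prod 𝓘(ℝ, ι → ℝ))
      (fun m => (⟨m, φ.frame a m⟩ : TotalSpace (ι → ℝ) F.Normal)) m :=
  ((φ.contMDiffOn_frame a).contMDiffAt (φ.chart.open_source.mem_nhds hm)).mdifferentiableAt
    (by simp)

/-- The linear change of normal coordinates between affine charts has vanishing
differential. -/
theorem hasMFDerivAt_changeL {D : CovariantDerivative I (ι → ℝ) F.Normal} {φ ψ : AdaptedChart F}
    (hφ : IsAffineChart D φ) (hψ : IsAffineChart D ψ) {m : M} (h : m ∈ φ.chart.source)
    (h' : m ∈ ψ.chart.source) :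
    HasMFDerivAt I 𝓘(ℝ, (ι → ℝ) →L[ℝ] (ι → ℝ)) (changeL φ ψ) m 0 := by
  have ho : φ.chart.source ∩ ψ.chart.source ∈ 𝓝 m :=
    (φ.chart.open_source.inter ψ.chart.open_source).mem_nhds ⟨h, h'⟩
  have hd : MDifferentiableAt I 𝓘(ℝ, (ι → ℝ) →L[ℝ] (ι → ℝ)) (changeL φ ψ) m :=
    ((contMDiffOn_changeL φ ψ).contMDiffAt ho).mdifferentiableAt (by simp)
  suffices hz : mfderiv I 𝓘(ℝ, (ι → ℝ) →L[ℝ] (ι → ℝ)) (changeL φ ψ) m = 0 by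
    have := hd.hasMFDerivAt
    rwa [hz] at this
  refine ContinuousLinearMap.ext fun v => ?_
  refine ContinuousLinearMap.coe_injective ((Pi.basisFun ℝ ι).ext fun j => ?_)
  let a : ι → M → ℝ := fun k m' => changeL φ ψ m' (Pi.single j 1) k
  let L : ι → ((ι → ℝ) →L[ℝ] (ι → ℝ)) →L[ℝ] ℝ := fun k =>
    (ContinuousLinearMap.proj k).comp (ContinuousLinearMap.apply ℝ (ι → ℝ) (Pi.single j (1 : ℝ)))
  have ha : ∀ k, HasMFDerivAt I 𝓘(ℝ, ℝ) (a k) m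
      ((L k).comp (mfderiv I 𝓘(ℝ, (ι → ℝ) →L[ℝ] (ι → ℝ)) (changeL φ ψ) m)) :=
    fun k => (L k).hasMFDerivAt.comp m hd.hasMFDerivAt
  have hs : ∀ k, MDifferentiableAt I (I.prod 𝓘(ℝ, ι → ℝ))
      (fun m => (⟨m, (a k • ψ.frame k) m⟩ : TotalSpace (ι → ℝ) F.Normal)) m :=
    fun k => (ha k).mdifferentiableAt.smul_section (ψ.mdifferentiableAt_frame h' k)
  have hsum := covariantDerivative_sum (D := D) Finset.univ hs
  have hev : ∀ᶠ m' in 𝓝 m, φ.frame j m' = (∑ k, a k • ψ.frame k) m' := by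
    filter_upwards [ho] with m' hm'
    have e : ψ.dy m' (φ.frame j m') = changeL φ ψ m' (Pi.single j 1) :=
      (changeL_apply φ ψ hm'.1 hm'.2 _).symm
    rw [← ψ.ofDy_dy hm'.2 (φ.frame j m'), e, ← ψ.sum_smul_frame hm'.2, Finset.sum_apply]
    rfl
  -- Applying `D` to `∂ⱼ = ∑ₖ aₖ ∂'ₖ`, where both frames are parallel, leaves `0 = ∑ₖ daₖ(v) ∂'ₖ`;
  -- independence of the frame gives `daₖ = 0`.
  have hD := D.isCovariantDerivativeOnUniv.congr_of_eventuallyEq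
    (φ.mdifferentiableAt_frame h j) hsum.2 Filter.univ_mem hev
  rw [hφ m h j, hsum.1] at hD
  have hk : ∀ k, D (a k • ψ.frame k) m v = mvfderiv I (a k) m v • ψ.frame k m := by
    intro k
    rw [D.isCovariantDerivativeOnUniv.leibniz (ψ.mdifferentiableAt_frame h' k)
      (ha k).mdifferentiableAt, hψ m h' k, smul_zero, zero_add]
    rfl
  have hD2 := congrArg (fun A => A v) hD
  simp only [FunLike.coe_sum, Finset.sum_apply, hk, zero_apply] at hD2
  rw [ψ.sum_smul_frame h'] at hD2
  have hD3 := congrArg (ψ.dy m) hD2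
  rw [map_zero, ψ.dy_ofDy h'] at hD3
  ext k
  have hD4 := congrFun hD3 k
  change (0 : ℝ) = mfderiv I 𝓘(ℝ, ℝ) (a k) m v at hD4
  rw [(ha k).mfderiv] at hD4
  rw [Pi.basisFun_apply]
  exact hD4.symm

/-- The transformation of the transverse coordinates `(y, dy)` under a change of affine charts. -/
theorem normalSplit_d_of_isAffineChart {D : CovariantDerivative I (ι → ℝ) F.Normal}
    {φ ψ : AdaptedChart F} (hφ : IsAffineChart D φ) (hψ : IsAffineChart D ψ)
    {ξ : TotalSpace (ι → ℝ) F.Normal} (h : ξ.1 ∈ φ.chart.source) (h' : ξ.1 ∈ ψ.chart.source)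
    (v : TangentSpace (I.prod 𝓘(ℝ, ι → ℝ)) ξ) :
    (ψ.normalSplit.d ξ v).2 = Sum.elim
      (changeL φ ψ ξ.1 ((φ.normalSplit.d ξ v).2 ∘ Sum.inl))
      (changeL φ ψ ξ.1 ((φ.normalSplit.d ξ v).2 ∘ Sum.inr)) := by
  let J := I.prod 𝓘(ℝ, ι → ℝ)
  let V := ι → ℝ
  have hφ' : HasMFDerivAt J 𝓘(ℝ, (Fin p → ℝ) × (ι ⊕ ι → ℝ)) φ.normalSplit.toFun ξ
      (φ.normalSplit.d ξ) :=
    (PartialDiffeomorph.mdifferentiableAt φ.normalSplit (by simp) h).hasMFDerivAt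
  have hψ' : HasMFDerivAt J 𝓘(ℝ, (Fin p → ℝ) × (ι ⊕ ι → ℝ)) ψ.normalSplit.toFun ξ
      (ψ.normalSplit.d ξ) :=
    (PartialDiffeomorph.mdifferentiableAt ψ.normalSplit (by simp) h').hasMFDerivAt
  let Pl : (Fin p → ℝ) × (ι ⊕ ι → ℝ) →L[ℝ] (Fin p → ℝ) × (ι → ℝ) :=
    (ContinuousLinearMap.fst ℝ _ _).prod ((ContinuousLinearMap.pi fun i =>
      ContinuousLinearMap.proj (Sum.inl i)).comp (ContinuousLinearMap.snd ℝ _ _))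
  let Pr : (Fin p → ℝ) × (ι ⊕ ι → ℝ) →L[ℝ] (ι → ℝ) :=
    (ContinuousLinearMap.pi fun i =>
      ContinuousLinearMap.proj (Sum.inr i)).comp (ContinuousLinearMap.snd ℝ _ _)
  have hz := mem_changeDomain φ ψ h h'
  have yφ : HasMFDerivAt J 𝓘(ℝ, (Fin p → ℝ) × (ι → ℝ)) (fun ζ : TotalSpace (ι → ℝ) F.Normal =>
      φ.chart.toFun ζ.1) ξ (Pl.comp (φ.normalSplit.d ξ)) :=
    Pl.hasMFDerivAt.comp ξ hφ'
  have yψ : HasMFDerivAt J 𝓘(ℝ, (Fin p → ℝ) × (ι → ℝ)) (fun ζ : TotalSpace (ι → ℝ) F.Normal =>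
      ψ.chart.toFun ζ.1) ξ (Pl.comp (ψ.normalSplit.d ξ)) :=
    Pl.hasMFDerivAt.comp ξ hψ'
  have hopen : ∀ χ : AdaptedChart F, ξ.1 ∈ χ.chart.source →
      ∀ᶠ ζ : TotalSpace (ι → ℝ) F.Normal in 𝓝 ξ, ζ.1 ∈ χ.chart.source := fun χ hχ =>
    χ.normalSplit.open_source.mem_nhds hχ
  have ey : (fun ζ : TotalSpace (ι → ℝ) F.Normal => ψ.chart.toFun ζ.1) =ᶠ[𝓝 ξ]
      change φ ψ ∘ fun ζ => φ.chart.toFun ζ.1 := by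
    filter_upwards [hopen φ h] with ζ hζ
    simp only [change, Function.comp]
    congr 1
    exact (φ.chart.left_inv hζ).symm
  have y1 := hasMFDerivAt_unique yψ
    ((HasMFDerivAt.comp (g := change φ ψ) ξ
      (differentiableAt_change φ ψ hz).hasFDerivAt.hasMFDerivAt yφ).congr_of_eventuallyEq ey)
  have y2 : Pl (ψ.normalSplit.d ξ v) =
      fderiv ℝ (change φ ψ) (φ.chart.toFun ξ.1) (Pl (φ.normalSplit.d ξ v)) :=
    congrArg (fun A => A v) y1
  have y3 : (Pl (ψ.normalSplit.d ξ v)).2 = changeL φ ψ ξ.1 (Pl (φ.normalSplit.d ξ v)).2 := by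
    rw [y2]
    have : Pl (φ.normalSplit.d ξ v) = ((Pl (φ.normalSplit.d ξ v)).1, 0) +
        (0, (Pl (φ.normalSplit.d ξ v)).2) := by simp
    -- The leaf component does not affect the new transverse coordinates.
    rw [this, map_add, Prod.snd_add, fderiv_change_inl φ ψ hz, zero_add]
    simp [changeL]
  have wφ : HasMFDerivAt J 𝓘(ℝ, ι → ℝ) (fun ζ : TotalSpace (ι → ℝ) F.Normal =>
      φ.dy ζ.1 ζ.2) ξ (Pr.comp (φ.normalSplit.d ξ)) :=
    Pr.hasMFDerivAt.comp ξ hφ'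
  have wψ : HasMFDerivAt J 𝓘(ℝ, ι → ℝ) (fun ζ : TotalSpace (ι → ℝ) F.Normal =>
      ψ.dy ζ.1 ζ.2) ξ (Pr.comp (ψ.normalSplit.d ξ)) :=
    Pr.hasMFDerivAt.comp ξ hψ'
  have hL : HasMFDerivAt J 𝓘(ℝ, V →L[ℝ] V)
      (fun ζ : TotalSpace (ι → ℝ) F.Normal => changeL φ ψ ζ.1) ξ 0 := by
    have := HasMFDerivAt.comp (g := changeL φ ψ) ξ (hasMFDerivAt_changeL hφ hψ h h')
      (mdifferentiableAt_proj (IB := I) F.Normal (p := ξ)).hasMFDerivAt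
    rwa [ContinuousLinearMap.zero_comp] at this
  have hp : HasMFDerivAt J 𝓘(ℝ, (V →L[ℝ] V) × V)
      (fun ζ : TotalSpace (ι → ℝ) F.Normal => (changeL φ ψ ζ.1, φ.dy ζ.1 ζ.2)) ξ
      (ContinuousLinearMap.prod 0 (Pr.comp (φ.normalSplit.d ξ))) :=
    ⟨hL.1.prodMk wφ.1, hL.2.prodMk wφ.2⟩
  have hb : HasFDerivAt (fun z : (V →L[ℝ] V) × V => z.1 z.2) _
      (changeL φ ψ ξ.1, φ.dy ξ.1 ξ.2) :=
    (isBoundedBilinearMap_apply (𝕜 := ℝ) (E := V) (F := V)).hasFDerivAt _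
  have ew : (fun ζ : TotalSpace (ι → ℝ) F.Normal => ψ.dy ζ.1 ζ.2) =ᶠ[𝓝 ξ]
      fun ζ => changeL φ ψ ζ.1 (φ.dy ζ.1 ζ.2) := by
    filter_upwards [hopen φ h, hopen ψ h'] with ζ h1 h2
    rw [changeL_apply φ ψ h1 h2, φ.ofDy_dy h1]
  have w1 := hasMFDerivAt_unique wψ
    ((HasMFDerivAt.comp (g := fun z : (V →L[ℝ] V) × V => z.1 z.2) ξ hb.hasMFDerivAt
      hp).congr_of_eventuallyEq ew)
  have w2 : Pr (ψ.normalSplit.d ξ v) = changeL φ ψ ξ.1 (Pr (φ.normalSplit.d ξ v)) := by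
    have := congrArg (fun A => A v) w1
    refine this.trans ?_
    -- In the product rule for `dy' = A · dy` the term with `dA` is zero. For charts that are not
    -- affine it would mix the `y`-part into the fibre part.
    change changeL φ ψ ξ.1 (Pr (φ.normalSplit.d ξ v)) + (0 : V →L[ℝ] V) (φ.dy ξ.1 ξ.2) = _
    simp
  ext (i | i)
  · exact congrFun y3 i
  · exact congrFun w2 i

theorem lift_dy_of_isAffineChart {D : CovariantDerivative I (ι → ℝ) F.Normal}
    {φ ψ : AdaptedChart F} (hφ : IsAffineChart D φ) (hψ : IsAffineChart D ψ)
    {ξ : TotalSpace (ι → ℝ) F.Normal} (h : ξ.1 ∈ φ.chart.source) (h' : ξ.1 ∈ ψ.chart.source)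
    (u : F.lift.Normal ξ) :
    ψ.lift.dy ξ u = Sum.elim (changeL φ ψ ξ.1 (φ.lift.dy ξ u ∘ Sum.inl))
      (changeL φ ψ ξ.1 (φ.lift.dy ξ u ∘ Sum.inr)) := by
  obtain ⟨v, rfl⟩ := F.lift.bar_surjective ξ u
  rw [dy_bar ψ.lift (m := ξ) h', dy_bar φ.lift (m := ξ) h]
  exact normalSplit_d_of_isAffineChart hφ hψ h h' v

/-- The metric `∑ gᵢⱼ dzⁱ dz̄ʲ` is the sum of `g` on the `y`-part and on the `dy`-part. -/
theorem re_sum_gram_dz (φ : AdaptedChart F)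
    (g : ContMDiffRiemannianMetric I ∞ (ι → ℝ) F.Normal) {ξ : TotalSpace (ι → ℝ) F.Normal}
    (h : ξ.1 ∈ φ.chart.source) (u w : F.lift.Normal ξ) :
    (∑ i, ∑ j, (φ.gram g ξ.1 i j : ℂ) * (φ.dz ξ i u * (starRingEnd ℂ) (φ.dz ξ j w))).re =
      g.inner ξ.1 (φ.ofDy ξ.1 (φ.lift.dy ξ u ∘ Sum.inl)) (φ.ofDy ξ.1 (φ.lift.dy ξ w ∘ Sum.inl)) +
      g.inner ξ.1 (φ.ofDy ξ.1 (φ.lift.dy ξ u ∘ Sum.inr))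
        (φ.ofDy ξ.1 (φ.lift.dy ξ w ∘ Sum.inr)) := by
  rw [φ.inner_ofDy g h, φ.inner_ofDy g h]
  simp only [Complex.re_sum, ← Finset.sum_add_distrib]
  refine Finset.sum_congr rfl fun i _ => Finset.sum_congr rfl fun j _ => ?_
  simp [dz]
  ring

/-- In any affine chart the expression is `g` on the `y`-part plus `g` on the `dy`-part, both viewed
as normal vectors of `M`. The common transition matrix does not change these vectors, so the chart
chosen in the definition is immaterial. -/
theorem kahlerMetric_eq {D : CovariantDerivative I (ι → ℝ) F.Normal}
    (g : ContMDiffRiemannianMetric I ∞ (ι → ℝ) F.Normal) {φ : AdaptedChart F}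
    (hφ : IsAffineChart D φ) {ξ : TotalSpace (ι → ℝ) F.Normal} (h : ξ.1 ∈ φ.chart.source)
    (u w : F.lift.Normal ξ) :
    kahlerMetric D g ξ u w =
      (∑ i, ∑ j, (φ.gram g ξ.1 i j : ℂ) * (φ.dz ξ i u * (starRingEnd ℂ) (φ.dz ξ j w))).re := by
  have hex : ∃ φ : AdaptedChart F, ξ.1 ∈ φ.chart.source ∧ IsAffineChart D φ := ⟨φ, h, hφ⟩
  obtain ⟨h', hψ⟩ := hex.choose_spec
  rw [kahlerMetric, dif_pos hex, re_sum_gram_dz _ g h', re_sum_gram_dz _ g h,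
    lift_dy_of_isAffineChart hφ hψ h h' u, lift_dy_of_isAffineChart hφ hψ h h' w]
  simp only [Sum.elim_comp_inl, Sum.elim_comp_inr, ofDy_changeL _ _ h h']

theorem kahlerMetric_frame {D : CovariantDerivative I (ι → ℝ) F.Normal}
    (g : ContMDiffRiemannianMetric I ∞ (ι → ℝ) F.Normal) {φ : AdaptedChart F}
    (hφ : IsAffineChart D φ) {ξ : TotalSpace (ι → ℝ) F.Normal} (h : ξ.1 ∈ φ.chart.source)
    (a b : ι ⊕ ι) :
    kahlerMetric D g ξ (φ.lift.frame a ξ) (φ.lift.frame b ξ) =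
      Matrix.fromBlocks (φ.gram g ξ.1) 0 0 (φ.gram g ξ.1) a b := by
  rw [kahlerMetric_eq g hφ h, re_sum_gram_dz φ g h, φ.inner_ofDy g h, φ.inner_ofDy g h,
    φ.lift.dy_frame (m := ξ) h, φ.lift.dy_frame (m := ξ) h]
  rcases a with a | a <;> rcases b with b | b <;> simp [Pi.single_apply]

/-- The transverse manifold is the slice through `ξ` with leaf coordinates frozen. On it the gram
matrix of the Kähler metric is block diagonal in the gram matrix of `g`, which near the base point
depends on `y` alone, so the two metrics have the same germ. -/
theorem normalRicci_kahlerMetric {D : CovariantDerivative I (ι → ℝ) F.Normal}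
    {g : ContMDiffRiemannianMetric I ∞ (ι → ℝ) F.Normal} {φ : AdaptedChart F}
    (hφ : IsAffineChart D φ) {ξ : TotalSpace (ι → ℝ) F.Normal} (h : ξ.1 ∈ φ.chart.source)
    {G : (ι → ℝ) → Matrix ι ι ℝ}
    (he : ∀ᶠ m' in 𝓝 ξ.1, φ.gram g m' = G (φ.chart.toFun m').2) :
    φ.lift.normalRicci (kahlerMetric D g) ξ =
      ricciCoord (doubleMetric G) (φ.lift.chart.toFun ξ).2 := by
  funext a b
  unfold normalRicci
  refine congrFun (congrFun (ricciCoord_congr ?_) a) b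
  let x : Fin p → ℝ := (φ.chart.toFun ξ.1).1
  let c₀ : ι ⊕ ι → ℝ := (φ.lift.chart.toFun ξ).2
  have e0 : (x, c₀ ∘ Sum.inl) = φ.chart.toFun ξ.1 := Prod.ext rfl rfl
  have hc : Continuous fun c : ι ⊕ ι → ℝ => (x, c ∘ Sum.inl) := by fun_prop
  have ht : (x, c₀ ∘ Sum.inl) ∈ φ.chart.target := by
    rw [e0]; exact φ.chart.map_source h
  have ht' : ∀ᶠ c in 𝓝 c₀, (x, c ∘ Sum.inl) ∈ φ.chart.target :=
    hc.continuousAt.eventually (φ.chart.open_target.mem_nhds ht)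
  have e1 : φ.chart.invFun (x, c₀ ∘ Sum.inl) = ξ.1 := by
    rw [e0]; exact φ.chart.left_inv h
  have hcont : ContinuousAt (fun c : ι ⊕ ι → ℝ => φ.chart.invFun (x, c ∘ Sum.inl)) c₀ :=
    ContinuousAt.comp (g := φ.chart.invFun)
      (φ.chart.contMDiffOn_invFun.continuousOn.continuousAt (φ.chart.open_target.mem_nhds ht))
      hc.continuousAt
  have he' : ∀ᶠ c in 𝓝 c₀, φ.gram g (φ.chart.invFun (x, c ∘ Sum.inl)) =
      G (φ.chart.toFun (φ.chart.invFun (x, c ∘ Sum.inl))).2 := by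
    rw [← e1] at he
    exact hcont.eventually he
  filter_upwards [ht', he'] with c h1 h2
  have h3 : φ.chart.toFun (φ.chart.invFun (x, c ∘ Sum.inl)) = (x, c ∘ Sum.inl) :=
    φ.chart.right_inv h1
  rw [h3] at h2
  ext a b
  refine (kahlerMetric_frame g hφ (ξ := φ.lift.chart.invFun (x, c))
    (φ.chart.map_target h1) a b).trans ?_
  change Matrix.fromBlocks (φ.gram g (φ.chart.invFun (x, c ∘ Sum.inl))) 0 0
    (φ.gram g (φ.chart.invFun (x, c ∘ Sum.inl))) a b = _
  rw [h2]
  rfl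

/-- The normal Ricci tensor of the Kähler metric of the normal bundle of a transversely Hessian
foliation is `-1/2` times the second normal Koszul form. -/
theorem hermitianComponent_normalRicci_kahlerMetric
    {D : CovariantDerivative I (ι → ℝ) F.Normal}
    {g : ContMDiffRiemannianMetric I ∞ (ι → ℝ) F.Normal} (hDg : IsTransverselyHessian D g)
    {φ : AdaptedChart F} (hφ : IsAffineChart D φ) {ξ : TotalSpace (ι → ℝ) F.Normal}
    (h : ξ.1 ∈ φ.chart.source) (i j : ι) :
    hermitianComponent (φ.lift.normalRicci (kahlerMetric D g) ξ) i j =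
      ((-(1 / 2) * φ.secondKoszulForm D g ξ.1 i j : ℝ) : ℂ) := by
  obtain ⟨G, U, hG, hpos, hU, he⟩ := exists_codazziMetric hDg φ hφ h
  have e0 : (φ.lift.chart.toFun ξ).2 ∘ Sum.inl = (φ.chart.toFun ξ.1).2 := Sum.elim_comp_inl _ _
  rw [normalRicci_kahlerMetric hφ h he, hG.hermitianComponent_ricciCoord_doubleMetric (e0 ▸ hU),
    secondKoszulForm_eq hφ h hG hpos hU he, e0]

end AdaptedChart

end Kahler

end TransverselyHessian

theorem mainTheorem10 {p q : ℕ} {M : Type*} [TopologicalSpace M] [T2Space M]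
    [SecondCountableTopology M] [ChartedSpace (EuclideanSpace ℝ (Fin (p + q))) M]
    [IsManifold (𝓡 (p + q)) ∞ M]
    (F : TransverselyHessian.Foliation (𝓡 (p + q)) M p (Fin q))
    (D : CovariantDerivative (𝓡 (p + q)) (Fin q → ℝ) F.Normal)
    (g : ContMDiffRiemannianMetric (𝓡 (p + q)) ∞ (Fin q → ℝ) F.Normal)
    (hDg : TransverselyHessian.IsTransverselyHessian D g)
    (φ : TransverselyHessian.AdaptedChart F) (hφ : TransverselyHessian.IsAffineChart D φ)
    (ξ : TotalSpace (Fin q → ℝ) F.Normal) (hξ : ξ.proj ∈ φ.chart.source) (i j : Fin q) :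
    TransverselyHessian.hermitianComponent
        (φ.lift.normalRicci (TransverselyHessian.kahlerMetric D g) ξ) i j =
      ((-(1 / 2) * φ.secondKoszulForm D g ξ.proj i j : ℝ) : ℂ) := by
  exact TransverselyHessian.AdaptedChart.hermitianComponent_normalRicci_kahlerMetric hDg hφ hξ i j
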